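/- **Market.** There are $n\ge 1$ men and $n$ women. Man $m$'s preference for woman $w$ is an unknown probability distribution $\mathcal D_{mw}$ on $[0,1]$ with mean $\mu_{mw}>0$, and $\mu_{mw}\ne\mu_{mw'}$ for $w\neq w'$; every woman $w$ has a strict linear order $>_w$ on the men. A *stable matching* is a bijection $a$ from men to women without men $m,m'$ such that $\mu_{m\,a(m')}>\mu_{m\,a(m)}$ and $m>_{a(m')}m'$. Put $\Delta=\min_{m,\,w\ne w'}|\mu_{mw}-\mu_{mw'}|$ ($\Delta=+\infty$ if $n=1$), $\mu_{\min}=\min_{m,w}\mu_{mw}$ and $\underline\Delta=\min\{\Delta,\mu_{\min}\}$. **Algorithm.** Parameters: episode lengths $\tau_m$, tolerance $\delta>0$, exploration probability $\varepsilon\in(0,1)$, inertia probability $\omega\in(0,1)$. The initial action profile is random with an arbitrary law, and it is the first baseline profile $b^1$. In episode $s=1,2,\dots$ of man $m$, i.e. at the times $t\in\{(s-1)\tau_m,\dots,s\tau_m-1\}$, he proposes to $\alpha^t_m$, which independently of everything else is his baseline $b^s_m$ with probability $1-\varepsilon$ and a uniformly drawn woman with probability $\varepsilon$. If $\alpha^t_m=w$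 and no $k>_w m$ has $\alpha^t_k=w$, he receives an independent sample $\mu^t_{mw}\sim\mathcal D_{mw}$, otherwise $0$. At the end of the episode he computes, for every $w$, the average $u^s_{mw}$ of what he received at those times of the episode at which he proposed to $w$ ($u^s_{mw}=0$ if there were none), and the set $\mathcal A^s_m=\{w: u^s_{mw}\ge u^s_{m b^s_m}+\delta\}$. If $\mathcal A^s_m\ne\emptyset$, then with probability $1-\omega$ his new baseline $b^{s+1}_m$ is drawn uniformly from $\mathcal A^s_m$; in all other cases $b^{s+1}_m=b^s_m$. **Theorem.** Let $n\ge1$, $p,\omega\in(0,1)$ and $0<\varepsilon\le\frac{1-p}{n}$. There is $\tau_0$, depending only on $n,p,\omega,\varepsilon$, such that for every $L\ge\tau_0$ the following holds. For every market with $n$ men and $n$ women, every $\delta\in(0,\underline\Delta)$ with $\varepsilon\le\min\{\frac{\delta}{4n},\frac{\underline\Delta-\delta}{4n}\}$ and every law of the initial profile, if all men follow the algorithm with episode lengths $\tau_m=L$, then there is $T$ such that for all $t\ge T$, with probability at least $p$, the profile $\alpha^t$ of proposals at time $t$ is a stable matching, namely the joint baseline profile in force at time $t$ (which is fixed throughout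 the current episode). -/

import Mathlib

open MeasureTheory

namespace MatchingMarket

/-- The men (players), `n` of them. -/
abbrev Man (n : ℕ) := Fin n

/-- The women (actions), also `n` of them. -/
abbrev Woman (n : ℕ) := Fin n

/-- A pure strategy profile: every man proposes to one woman. -/
abbrev Profile (n : ℕ) := Man n → Woman n

/-- A two-sided matching market with `n` men and `n` women.  `rewardLaw m w` is the distribution
`𝒟_{mw}` on `[0, 1]` of the sampled preference of man `m` for woman `w`, its mean being the true
preference `μ_{mw} > 0`; `prefers w k m` says that woman `w` strictly prefers man `k` to man `m`.
No agent has ties. -/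
structure Market (n : ℕ) where
  rewardLaw : Man n → Woman n → Measure ℝ
  prefers : Woman n → Man n → Man n → Prop
  rewardLaw_prob : ∀ m w, IsProbabilityMeasure (rewardLaw m w)
  rewardLaw_supp : ∀ m w, ∀ᵐ r ∂rewardLaw m w, r ∈ Set.Icc (0 : ℝ) 1
  mean_pos : ∀ m w, 0 < ∫ r, r ∂rewardLaw m w
  men_noTies : ∀ m w w', w ≠ w' → (∫ r, r ∂rewardLaw m w) ≠ ∫ r, r ∂rewardLaw m w'
  prefers_irrefl : ∀ w m, ¬ prefers w m m
  prefers_trans : ∀ w m₁ m₂ m₃, prefers w m₁ m₂ → prefers w m₂ m₃ → prefers w m₁ m₃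
  prefers_total : ∀ w m m', m ≠ m' → prefers w m m' ∨ prefers w m' m

noncomputable section

instance {n : ℕ} (𝓜 : Market n) (m : Man n) (w : Woman n) :
    IsProbabilityMeasure (𝓜.rewardLaw m w) := 𝓜.rewardLaw_prob m w

/-- The true preference `μ_{mw}`. -/
def Market.mean {n : ℕ} (𝓜 : Market n) (m : Man n) (w : Woman n) : ℝ :=
  ∫ r, r ∂𝓜.rewardLaw m w

/-- The least of the numbers `μ_{mw}` and `|μ_{mw} - μ_{mw'}|` (`w ≠ w'`), that is
`min {μ_min, Δ}`; for `n = 1` there are no differences and it is `μ_min`. -/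
def Market.gap {n : ℕ} (𝓜 : Market n) : ℝ :=
  sInf ({x | ∃ m w, x = 𝓜.mean m w} ∪
    {x | ∃ m w w', w ≠ w' ∧ x = |𝓜.mean m w - 𝓜.mean m w'|})

/-- The profile `a` is a perfect matching (man `m` being matched with `a m`) without a blocking
pair: there are no matched pairs `(m, a m)` and `(m', a m')` such that `m` prefers `a m'` to
`a m` and `a m'` prefers `m` to `m'`. -/
def Market.IsStableMatching {n : ℕ} (𝓜 : Market n) (a : Profile n) : Prop :=
  Function.Bijective a ∧
    ¬ ∃ m m', 𝓜.mean m (a m) < 𝓜.mean m (a m') ∧ 𝓜.prefers (a m') m m'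

/-! ### The randomness -/

/-- The random numbers that concern one man at one time step: a uniform number in `[0, 1]`
deciding whether he explores, a uniformly drawn woman, the sampled preferences for all women (of
which he gets to see at most one), a uniform number in `[0, 1]` deciding about inertia, and for
every set of women a uniformly drawn element of it (of which at most one is used). -/
abbrev ManNoise (n : ℕ) :=
  unitInterval × Woman n × (Woman n → ℝ) × unitInterval × (Finset (Woman n) → Woman n)

def ManNoise.exploreCoin {n : ℕ} (z : ManNoise n) : unitInterval := z.1
def ManNoise.exploreAction {n : ℕ} (z : ManNoise n) : Woman n := z.2.1
def ManNoise.reward {n : ℕ} (z : ManNoise n) : Woman n → ℝ := z.2.2.1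
def ManNoise.inertiaCoin {n : ℕ} (z : ManNoise n) : unitInterval := z.2.2.2.1
def ManNoise.pick {n : ℕ} (z : ManNoise n) : Finset (Woman n) → Woman n := z.2.2.2.2

abbrev Noise (n : ℕ) := Man n → ManNoise n

/-- The uniform distribution on the set `A` of women (on all women if `A` is empty, a value that
the algorithm never uses). -/
def pickLaw (n : ℕ) [NeZero n] (A : Finset (Woman n)) : Measure (Woman n) :=
  (if h : A.Nonempty then PMF.uniformOfFinset A h
    else PMF.uniformOfFintype (Woman n)).toMeasure

instance (n : ℕ) [NeZero n] (A : Finset (Woman n)) : IsProbabilityMeasure (pickLaw n A) := by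
  unfold pickLaw; infer_instance

/-- The joint law of all random numbers of one time step: everything is independent. -/
def noiseLaw {n : ℕ} [NeZero n] (𝓜 : Market n) : Measure (Noise n) :=
  Measure.pi fun m =>
    (volume : Measure unitInterval).prod
      ((PMF.uniformOfFintype (Woman n)).toMeasure.prod
        ((Measure.pi fun w => 𝓜.rewardLaw m w).prod
          ((volume : Measure unitInterval).prod (Measure.pi fun A => pickLaw n A))))

instance {n : ℕ} [NeZero n] (𝓜 : Market n) : IsProbabilityMeasure (noiseLaw 𝓜) := by
  unfold noiseLaw; infer_instance

/-- The sample space: the initial actions and the random numbers of all time steps. -/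
abbrev SampleSpace (n : ℕ) := Profile n × (ℕ → Noise n)

/-- The initial profile has law `ν`; the random numbers of the time steps `0, 1, 2, …` are
independent of it and i.i.d. -/
def pathLaw {n : ℕ} [NeZero n] (𝓜 : Market n) (ν : Measure (Profile n)) :
    Measure (SampleSpace n) :=
  ν.prod (Measure.infinitePi fun _ : ℕ => noiseLaw 𝓜)

/-! ### The sample-experimentation algorithm -/

/-- What the men remember at a time `t`: their baseline actions and, for the part of the current
episode before time `t`, how often man `m` proposed to `w` (`count m w`) and the sum of the
rewards that he received from `w` (`total m w`). -/
structure State (n : ℕ) where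
  baseline : Profile n
  count : Man n → Woman n → ℕ
  total : Man n → Woman n → ℝ

/-- With probability `ε` a man proposes to a uniformly drawn woman, otherwise he plays his
baseline action. -/
def propose {n : ℕ} (ε : ℝ) (b : Profile n) (z : Noise n) : Profile n := fun m =>
  if ((z m).exploreCoin : ℝ) < ε then (z m).exploreAction else b m

open Classical in
/-- The reward of man `m` under the profile `a` for the action `w`: if he proposes to `w` and is
accepted (no man whom `w` prefers proposes to her), his sampled preference, otherwise `0`. -/
def Market.payoff {n : ℕ} (𝓜 : Market n) (a : Profile n) (z : Noise n) (m : Man n)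
    (w : Woman n) : ℝ :=
  if a m = w ∧ ∀ k, 𝓜.prefers w k m → a k ≠ w then (z m).reward w else 0

open Classical in
/-- The set `{w : u w ≥ u b + δ}` of the actions that look better than the baseline action `b`
by the tolerance `δ`. -/
def improving {n : ℕ} (δ : ℝ) (u : Woman n → ℝ) (b : Woman n) : Finset (Woman n) :=
  Finset.univ.filter fun w => u b + δ ≤ u w

open Classical in
/-- The new baseline action: if no action looks better, or with the inertia probability `ω`, the
old one is kept; otherwise it is drawn uniformly from the actions that look better. -/
def nextBaseline {n : ℕ} (δ ω : ℝ) (u : Woman n → ℝ) (b : Woman n) (z : ManNoise n) :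
    Woman n :=
  if (improving δ u b).Nonempty ∧ ω ≤ (z.inertiaCoin : ℝ) then z.pick (improving δ u b) else b

/-- Time step `t`.  The men propose and update their tallies.  The `s`-th episode of man `m`
consists of the times `(s - 1) * τ m, …, s * τ m - 1`; so if `τ m` divides `t + 1`, it ends with
this step: the man then evaluates the average reward of every action (`0` for an action that he
did not play), updates his baseline action and clears his tallies. -/
def step {n : ℕ} (𝓜 : Market n) (τ : Man n → ℕ) (ε δ ω : ℝ) (t : ℕ) (z : Noise n)
    (S : State n) : State n :=
  let a : Profile n := propose ε S.baseline z
  let count : Man n → Woman n → ℕ := fun m w => S.count m w + if a m = w then 1 else 0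
  let total : Man n → Woman n → ℝ := fun m w => S.total m w + 𝓜.payoff a z m w
  { baseline := fun m =>
      if τ m ∣ t + 1 then
        nextBaseline δ ω (fun w => total m w / (count m w : ℝ)) (S.baseline m) (z m)
      else S.baseline m
    count := fun m w => if τ m ∣ t + 1 then 0 else count m w
    total := fun m w => if τ m ∣ t + 1 then 0 else total m w }

/-- The state before time step `t`; the first baseline profile is the initial profile. -/
def state {n : ℕ} (𝓜 : Market n) (τ : Man n → ℕ) (ε δ ω : ℝ) (x : SampleSpace n) :
    ℕ → State n
  | 0 => { baseline := x.1, count := fun _ _ => 0, total := fun _ _ => 0 }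
  | t + 1 => step 𝓜 τ ε δ ω t (x.2 t) (state 𝓜 τ ε δ ω x t)

/-- The joint baseline profile in force at time `t`. -/
def baseline {n : ℕ} (𝓜 : Market n) (τ : Man n → ℕ) (ε δ ω : ℝ) (x : SampleSpace n)
    (t : ℕ) : Profile n :=
  (state 𝓜 τ ε δ ω x t).baseline

/-- The profile `α^t` of proposals at time `t`. -/
def proposal {n : ℕ} (𝓜 : Market n) (τ : Man n → ℕ) (ε δ ω : ℝ) (x : SampleSpace n)
    (t : ℕ) : Profile n :=
  propose ε (baseline 𝓜 τ ε δ ω x t) (x.2 t)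

end

end MatchingMarket

namespace MatchingMarket

/-! Regard the market as a game in which a man earns `mean m w` if no man whom `w` prefers proposes
to her, and `0` otherwise. A profile without better replies is a stable matching
(`IsNash.isStableMatching`), and from every profile a path of single better replies leads to such a
profile (`exists_potential_lt`). While some accepted man has a better reply, let one such man move;
this raises him in his own ranking. Once no accepted man has one, let a rejected man move to a best
reply; his departure helps nobody, so accepted men remain content, and the women's best proposers
only improve. A two-phase `potential`, bounded by a polynomial in `n`, falls at each move.

Exploration perturbs the expected payoff per proposal by at most `ε`, and every woman is tried with
probability at least `ε / n`. By Chebyshev's inequality all averages of an episode of length `L` are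
within `2ε` of the utilities, except with probability `32 n⁴ / (ε⁴ L)`. As `4ε` is at most `δ` and
at most `gap - δ`, the sets of actions that look better are then exactly the sets of better replies.
So an equilibrium is kept, and elsewhere, thanks to inertia, any given better reply of any given man
is the only move with probability at least about `κ = min(ω, (1-ω)/n)ⁿ`.

The baselines of successive episodes form a finite Markov chain. Equilibria are left with small
probability `η` and are reached within `N` episodes with probability at least `(κ/2)^N`, so if `η`
is small enough the chain is eventually at an equilibrium with high probability
(`eventually_sum_pow_ge`). All these bounds are uniform over markets, and so is the required `L`.
Finally, nobody deviates from the baseline at a given time with probability at least `1 - nε + ε`;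
the extra `ε` absorbs the failure probability of the chain. -/

variable {n : ℕ}

/-! ### Stable matchings as equilibria of a game -/

/-- Man `m` would be accepted by `w` if the other men play `b`. -/
def Market.Accepts (𝓜 : Market n) (b : Profile n) (m : Man n) (w : Woman n) : Prop :=
  ∀ k, 𝓜.prefers w k m → b k ≠ w

open Classical in
/-- The expected payoff of man `m` for proposing to `w` if the other men play `b`. -/
noncomputable def Market.utility (𝓜 : Market n) (b : Profile n) (m : Man n) (w : Woman n) : ℝ :=
  if 𝓜.Accepts b m w then 𝓜.mean m w else 0

open Classical in
/-- The better replies of man `m` to the profile `b`. -/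
noncomputable def Market.betterReplies (𝓜 : Market n) (b : Profile n) (m : Man n) :
    Finset (Woman n) :=
  Finset.univ.filter fun w => 𝓜.utility b m (b m) < 𝓜.utility b m w

/-- No man has a better reply. -/
def Market.IsNash (𝓜 : Market n) (b : Profile n) : Prop :=
  ∀ m, 𝓜.betterReplies b m = ∅

lemma Market.mem_betterReplies {𝓜 : Market n} {b : Profile n} {m : Man n} {w : Woman n} :
    w ∈ 𝓜.betterReplies b m ↔ 𝓜.utility b m (b m) < 𝓜.utility b m w := by
  simp [Market.betterReplies]

lemma Market.mean_pos' (𝓜 : Market n) (m : Man n) (w : Woman n) : 0 < 𝓜.mean m w :=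
  𝓜.mean_pos m w

lemma Market.utility_of_accepts {𝓜 : Market n} {b : Profile n} {m : Man n} {w : Woman n}
    (h : 𝓜.Accepts b m w) : 𝓜.utility b m w = 𝓜.mean m w := if_pos h

lemma Market.utility_of_not_accepts {𝓜 : Market n} {b : Profile n} {m : Man n} {w : Woman n}
    (h : ¬ 𝓜.Accepts b m w) : 𝓜.utility b m w = 0 := if_neg h

lemma Market.utility_nonneg (𝓜 : Market n) (b : Profile n) (m : Man n) (w : Woman n) :
    0 ≤ 𝓜.utility b m w := by
  unfold Market.utility; split_ifs
  exacts [(𝓜.mean_pos' m w).le, le_rfl]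

lemma Market.utility_le_mean (𝓜 : Market n) (b : Profile n) (m : Man n) (w : Woman n) :
    𝓜.utility b m w ≤ 𝓜.mean m w := by
  unfold Market.utility; split_ifs
  exacts [le_rfl, (𝓜.mean_pos' m w).le]

lemma Market.accepts_of_utility_pos {𝓜 : Market n} {b : Profile n} {m : Man n} {w : Woman n}
    (h : 0 < 𝓜.utility b m w) : 𝓜.Accepts b m w := by
  by_contra hc
  rw [Market.utility_of_not_accepts hc] at h
  exact lt_irrefl _ h

/-- A rejected man shares his woman with a rival, so the profile is not injective and, by
finiteness, misses some woman. She would accept him, and a positive mean beats `0`. -/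
lemma Market.IsNash.accepts {𝓜 : Market n} {b : Profile n} (hb : 𝓜.IsNash b) (m : Man n) :
    𝓜.Accepts b m (b m) := by
  by_contra hc
  have hc' : ∃ k, 𝓜.prefers (b m) k m ∧ b k = b m := by
    simpa [Market.Accepts] using hc
  obtain ⟨k, hk, hkm⟩ := hc'
  have hinj : ¬ Function.Injective b := fun h => by
    rw [h hkm] at hk
    exact 𝓜.prefers_irrefl _ _ hk
  have hsurj : ¬ Function.Surjective b := fun h => hinj (Finite.injective_iff_surjective.2 h)
  obtain ⟨w, hw⟩ := not_forall.1 hsurj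
  have hacc : 𝓜.Accepts b m w := fun j _ hj => hw ⟨j, hj⟩
  have : w ∈ 𝓜.betterReplies b m := by
    rw [Market.mem_betterReplies, Market.utility_of_accepts hacc,
      Market.utility_of_not_accepts hc]
    exact 𝓜.mean_pos' m w
  simp [hb m] at this

/-- A profile without better replies is a stable matching. -/
lemma Market.IsNash.isStableMatching {𝓜 : Market n} {b : Profile n} (hb : 𝓜.IsNash b) :
    𝓜.IsStableMatching b := by
  have hinj : Function.Injective b := by
    intro k m hkm
    by_contra hne
    rcases 𝓜.prefers_total (b m) k m hne with h | h
    · exact hb.accepts m k h hkm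
    · rw [← hkm] at h
      exact hb.accepts k m h hkm.symm
  refine ⟨Finite.injective_iff_bijective.1 hinj, ?_⟩
  rintro ⟨m, m', hlt, hpref⟩
  have hacc : 𝓜.Accepts b m (b m') := by
    intro k hk hkm
    rw [hinj hkm] at hk
    exact 𝓜.prefers_irrefl _ _ (𝓜.prefers_trans _ _ _ _ hk hpref)
  have : b m' ∈ 𝓜.betterReplies b m := by
    rw [Market.mem_betterReplies, Market.utility_of_accepts hacc,
      Market.utility_of_accepts (hb.accepts m)]
    exact hlt
  simp [hb m] at this

/-! ### Paths of better replies -/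

/-- Men who are accepted have no better replies. -/
def Market.AcceptedContent (𝓜 : Market n) (b : Profile n) : Prop :=
  ∀ m, 𝓜.Accepts b m (b m) → 𝓜.betterReplies b m = ∅

open Classical in
/-- The number of pairs `(m, w)` such that `m` prefers `w` to `b m`. -/
noncomputable def Market.menRank (𝓜 : Market n) (b : Profile n) : ℕ :=
  ∑ m, (Finset.univ.filter fun w => 𝓜.mean m (b m) < 𝓜.mean m w).card

open Classical in
/-- The men whom `w` prefers to all men that propose to her. -/
noncomputable def Market.above (𝓜 : Market n) (b : Profile n) (w : Woman n) : Finset (Man n) :=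
  Finset.univ.filter fun i => ∀ k, b k = w → 𝓜.prefers w i k

open Classical in
/-- A quantity that decreases along suitable better replies. -/
noncomputable def Market.potential (𝓜 : Market n) (b : Profile n) : ℕ :=
  if 𝓜.AcceptedContent b then ∑ w, (𝓜.above b w).card else n * n + 1 + 𝓜.menRank b

lemma Market.menRank_le (𝓜 : Market n) (b : Profile n) : 𝓜.menRank b ≤ n * n := by
  refine (Finset.sum_le_card_nsmul _ _ n fun m _ => ?_).trans (by simp)
  exact (Finset.card_le_univ _).trans (by simp)

lemma Market.sum_card_above_le (𝓜 : Market n) (b : Profile n) :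
    ∑ w, (𝓜.above b w).card ≤ n * n := by
  refine (Finset.sum_le_card_nsmul _ _ n fun m _ => ?_).trans (by simp)
  exact (Finset.card_le_univ _).trans (by simp)

lemma Market.potential_le (𝓜 : Market n) (b : Profile n) :
    𝓜.potential b ≤ 2 * (n * n) + 1 := by
  unfold Market.potential
  have h1 := 𝓜.menRank_le b
  have h2 := 𝓜.sum_card_above_le b
  split_ifs <;> omega

lemma Market.accepts_update (𝓜 : Market n) (b : Profile n) (m : Man n) (w x : Woman n) :
    𝓜.Accepts (Function.update b m w) m x ↔ 𝓜.Accepts b m x := by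
  refine forall_congr' fun k => imp_congr_right fun hk => ?_
  have : k ≠ m := fun h => 𝓜.prefers_irrefl x m (h ▸ hk)
  rw [Function.update_of_ne this]

lemma Market.utility_update (𝓜 : Market n) (b : Profile n) (m : Man n) (w x : Woman n) :
    𝓜.utility (Function.update b m w) m x = 𝓜.utility b m x := by
  unfold Market.utility
  rw [𝓜.accepts_update]

/-- A rejected man does not matter to the other men. -/
lemma Market.exists_preferred_of_not_accepts {𝓜 : Market n} {b : Profile n} {m : Man n}
    (hm : ¬ 𝓜.Accepts b m (b m)) (w : Woman n) :
    ∃ k, 𝓜.prefers (b m) k m ∧ Function.update b m w k = b m := by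
  have hc' : ∃ k, 𝓜.prefers (b m) k m ∧ b k = b m := by
    simpa [Market.Accepts] using hm
  obtain ⟨k, hk, hkm⟩ := hc'
  have : k ≠ m := fun h => 𝓜.prefers_irrefl (b m) m (h ▸ hk)
  exact ⟨k, hk, by rw [Function.update_of_ne this, hkm]⟩

/-- Wherever the rejected man `m` stood in someone's way, the rival who beats him there still does,
by transitivity. Hence his departure opens no place. -/
lemma Market.accepts_of_accepts_update {𝓜 : Market n} {b : Profile n} {m j : Man n}
    {w x : Woman n} (hm : ¬ 𝓜.Accepts b m (b m))
    (h : 𝓜.Accepts (Function.update b m w) j x) : 𝓜.Accepts b j x := by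
  intro k hk hkx
  by_cases hkm : k = m
  · subst hkm
    obtain ⟨i, hi, hix⟩ := Market.exists_preferred_of_not_accepts hm w
    rw [hkx] at hi hix
    exact h i (𝓜.prefers_trans _ _ _ _ hi hk) hix
  · exact h k hk (by rw [Function.update_of_ne hkm, hkx])

/-- The mover is content because `w` is a best reply. Any other man accepted now was accepted
before, and his options have only shrunk. -/
lemma Market.acceptedContent_update {𝓜 : Market n} {b : Profile n} {m : Man n} {w : Woman n}
    (hb : 𝓜.AcceptedContent b) (hm : ¬ 𝓜.Accepts b m (b m))
    (hw : ∀ x, 𝓜.utility b m x ≤ 𝓜.utility b m w) :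
    𝓜.AcceptedContent (Function.update b m w) := by
  intro j hj
  rw [Finset.eq_empty_iff_forall_notMem]
  intro x hx
  rw [Market.mem_betterReplies] at hx
  by_cases hjm : j = m
  · subst hjm
    rw [Function.update_self, 𝓜.utility_update, 𝓜.utility_update] at hx
    exact (hw x).not_gt hx
  · rw [Market.utility_of_accepts hj] at hx
    rw [Function.update_of_ne hjm] at hj hx
    have hj' := Market.accepts_of_accepts_update hm hj
    have hx' : 𝓜.Accepts (Function.update b m w) j x :=
      Market.accepts_of_utility_pos ((𝓜.mean_pos' _ _).trans hx)
    have : x ∈ 𝓜.betterReplies b j := by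
      rw [Market.mem_betterReplies, Market.utility_of_accepts hj',
        Market.utility_of_accepts (Market.accepts_of_accepts_update hm hx')]
      rwa [Market.utility_of_accepts hx'] at hx
    simp [hb j hj'] at this

/-- No woman loses by the move: she whom `m` leaves keeps a better proposer. The new woman `w` gains
strictly, since `m` beats all her previous proposers and so drops out of `above b w`. -/
lemma Market.sum_card_above_update_lt {𝓜 : Market n} {b : Profile n} {m : Man n} {w : Woman n}
    (hm : ¬ 𝓜.Accepts b m (b m)) (hw : w ∈ 𝓜.betterReplies b m) :
    ∑ x, (𝓜.above (Function.update b m w) x).card < ∑ x, (𝓜.above b x).card := by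
  rw [Market.mem_betterReplies] at hw
  have hacc : 𝓜.Accepts b m w :=
    Market.accepts_of_utility_pos ((𝓜.utility_nonneg _ _ _).trans_lt hw)
  have hsub : ∀ x, 𝓜.above (Function.update b m w) x ⊆ 𝓜.above b x := by
    intro x i hi
    simp only [Market.above, Finset.mem_filter, Finset.mem_univ, true_and] at hi ⊢
    intro k hkx
    by_cases hkm : k = m
    · subst hkm
      obtain ⟨j, hj, hjx⟩ := Market.exists_preferred_of_not_accepts hm w
      rw [hkx] at hj hjx
      exact 𝓜.prefers_trans _ _ _ _ (hi j hjx) hj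
    · exact hi k (by rw [Function.update_of_ne hkm, hkx])
  refine Finset.sum_lt_sum (fun x _ => Finset.card_le_card (hsub x))
    ⟨w, Finset.mem_univ _, Finset.card_lt_card ⟨hsub w, fun hsup => ?_⟩⟩
  have hmem : m ∈ 𝓜.above b w := by
    simp only [Market.above, Finset.mem_filter, Finset.mem_univ, true_and]
    intro k hk
    have hkm : m ≠ k := by
      rintro rfl
      rw [hk] at hw
      exact lt_irrefl _ hw
    exact (𝓜.prefers_total w m k hkm).resolve_right fun h => hacc k h hk
  have := hsup hmem
  simp only [Market.above, Finset.mem_filter, Finset.mem_univ, true_and] at this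
  exact 𝓜.prefers_irrefl w m (this m (Function.update_self ..))

lemma Market.menRank_update_lt {𝓜 : Market n} {b : Profile n} {m : Man n} {w : Woman n}
    (hw : 𝓜.mean m (b m) < 𝓜.mean m w) :
    𝓜.menRank (Function.update b m w) < 𝓜.menRank b := by
  refine Finset.sum_lt_sum (fun j _ => Finset.card_le_card ?_)
    ⟨m, Finset.mem_univ _, Finset.card_lt_card ?_⟩
  · intro x hx
    simp only [Finset.mem_filter, Finset.mem_univ, true_and] at hx ⊢
    by_cases hjm : j = m
    · subst hjm
      rw [Function.update_self] at hx
      exact hw.trans hx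
    · rwa [Function.update_of_ne hjm] at hx
  · rw [Function.update_self, Finset.ssubset_iff_of_subset]
    · exact ⟨w, by simpa using hw, by simp⟩
    · intro x hx
      simp only [Finset.mem_filter, Finset.mem_univ, true_and] at hx ⊢
      exact hw.trans hx

/-- As long as some man has a better reply, there is one that decreases the potential. -/
lemma Market.exists_potential_lt {𝓜 : Market n} {b : Profile n} (hb : ¬ 𝓜.IsNash b) :
    ∃ m, ∃ w ∈ 𝓜.betterReplies b m,
      𝓜.potential (Function.update b m w) < 𝓜.potential b := by
  by_cases hc : 𝓜.AcceptedContent b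
  · obtain ⟨m, hm⟩ := not_forall.1 hb
    obtain ⟨y, hy⟩ := Finset.nonempty_iff_ne_empty.2 hm
    -- A best reply, not just a better one, so that the mover is content afterwards and the second
    -- phase persists.
    obtain ⟨w, -, hw⟩ := Finset.exists_max_image Finset.univ (𝓜.utility b m) ⟨y, Finset.mem_univ _⟩
    have hrej : ¬ 𝓜.Accepts b m (b m) := fun h => hm (hc m h)
    have hwb : w ∈ 𝓜.betterReplies b m := by
      rw [Market.mem_betterReplies] at hy ⊢
      exact hy.trans_le (hw y (Finset.mem_univ _))
    refine ⟨m, w, hwb, ?_⟩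
    rw [Market.potential, Market.potential, if_pos hc,
      if_pos (Market.acceptedContent_update hc hrej fun x => hw x (Finset.mem_univ _))]
    exact Market.sum_card_above_update_lt hrej hwb
  · have hc' : ∃ m, 𝓜.Accepts b m (b m) ∧ 𝓜.betterReplies b m ≠ ∅ := by
      simpa [Market.AcceptedContent] using hc
    obtain ⟨m, hacc, hm⟩ := hc'
    obtain ⟨w, hw⟩ := Finset.nonempty_iff_ne_empty.2 hm
    refine ⟨m, w, hw, ?_⟩
    rw [Market.mem_betterReplies, Market.utility_of_accepts hacc] at hw
    have h1 := Market.menRank_update_lt (hw.trans_le (𝓜.utility_le_mean _ _ _))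
    have h2 := 𝓜.sum_card_above_le (Function.update b m w)
    -- The offset `n * n + 1` exceeds every second-phase value, so the potential drops whether or
    -- not the move ends the first phase.
    rw [Market.potential, Market.potential, if_neg hc]
    split_ifs <;> omega

/-! ### Finite Markov chains with an almost absorbing set -/

section Stochastic

variable {α : Type*} [Fintype α] [DecidableEq α]

lemma stochastic_pow {M : Matrix α α ℝ} (h0 : ∀ b c, 0 ≤ M b c) (h1 : ∀ b, ∑ c, M b c = 1)
    (k : ℕ) : (∀ b c, 0 ≤ (M ^ k) b c) ∧ ∀ b, ∑ c, (M ^ k) b c = 1 := by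
  induction k with
  | zero =>
    refine ⟨fun b c => ?_, fun b => ?_⟩
    · rw [pow_zero, Matrix.one_apply]; split_ifs <;> norm_num
    · simp [Matrix.one_apply]
  | succ k ih =>
    refine ⟨fun b c => ?_, fun b => ?_⟩
    · rw [pow_succ, Matrix.mul_apply]
      exact Finset.sum_nonneg fun j _ => mul_nonneg (ih.1 _ _) (h0 _ _)
    · simp only [pow_succ, Matrix.mul_apply]
      rw [Finset.sum_comm]
      simp_rw [← Finset.mul_sum, h1, mul_one]
      exact ih.2 b

variable {M : Matrix α α ℝ} {S : Finset α} {ψ : α → ℕ} {ρ η : ℝ}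

lemma sum_pow_add (k l : ℕ) (b : α) :
    ∑ c ∈ S, (M ^ (k + l)) b c = ∑ d, (M ^ k) b d * ∑ c ∈ S, (M ^ l) d c := by
  simp only [pow_add, Matrix.mul_apply]
  rw [Finset.sum_comm]
  simp_rw [Finset.mul_sum]

lemma sum_pow_succ_ge (h0 : ∀ b c, 0 ≤ M b c) (h1 : ∀ b, ∑ c, M b c = 1) (k : ℕ) (b d : α) :
    M b d * ∑ c ∈ S, (M ^ k) d c ≤ ∑ c ∈ S, (M ^ (k + 1)) b c := by
  rw [add_comm, sum_pow_add, pow_one]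
  exact Finset.single_le_sum (f := fun d => M b d * ∑ c ∈ S, (M ^ k) d c)
    (fun i _ => mul_nonneg (h0 _ _)
      (Finset.sum_nonneg fun c _ => (stochastic_pow h0 h1 k).1 _ _)) (Finset.mem_univ d)

lemma sum_pow_ge_of_mem (h0 : ∀ b c, 0 ≤ M b c) (h1 : ∀ b, ∑ c, M b c = 1) (hη1 : η ≤ 1)
    (hS : ∀ b ∈ S, 1 - η ≤ M b b) (k : ℕ) {b : α} (hb : b ∈ S) :
    (1 - η) ^ k ≤ ∑ c ∈ S, (M ^ k) b c := by
  induction k with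
  | zero => simp [Matrix.one_apply, hb]
  | succ k ih =>
    refine le_trans ?_ (sum_pow_succ_ge h0 h1 k b b)
    rw [pow_succ, mul_comm]
    exact mul_le_mul (hS b hb) ih (pow_nonneg (by linarith) _) (h0 _ _)

/-- Follow the descending path until it meets `S`, paying `ρ` per step, and then stand still, paying
`1 - η ≥ ρ` per step. -/
lemma sum_pow_ge (h0 : ∀ b c, 0 ≤ M b c) (h1 : ∀ b, ∑ c, M b c = 1) (hρ0 : 0 ≤ ρ)
    (hρ : ρ ≤ 1 - η) (hS : ∀ b ∈ S, 1 - η ≤ M b b)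
    (hstep : ∀ b ∉ S, ∃ d, ψ d < ψ b ∧ ρ ≤ M b d) (k : ℕ) :
    ∀ b, ψ b ≤ k → ρ ^ k ≤ ∑ c ∈ S, (M ^ k) b c := by
  have hmem : ∀ (k : ℕ), ∀ b ∈ S, ρ ^ k ≤ ∑ c ∈ S, (M ^ k) b c := fun k b hb =>
    (pow_le_pow_left₀ hρ0 hρ k).trans
      (sum_pow_ge_of_mem h0 h1 (by linarith) hS k hb)
  induction k with
  | zero =>
    intro b hψ
    by_cases hb : b ∈ S
    · exact hmem 0 b hb
    · obtain ⟨d, hd, -⟩ := hstep b hb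
      omega
  | succ k ih =>
    intro b hψ
    by_cases hb : b ∈ S
    · exact hmem _ b hb
    · obtain ⟨d, hd, hρd⟩ := hstep b hb
      refine le_trans ?_ (sum_pow_succ_ge h0 h1 k b d)
      rw [pow_succ, mul_comm]
      exact mul_le_mul hρd (ih d (by omega)) (pow_nonneg hρ0 _) (h0 _ _)

/-- A finite Markov chain that hardly leaves `S` and reaches `S` from everywhere with a
probability that is not too small is eventually in `S` with high probability. -/
theorem eventually_sum_pow_ge (h0 : ∀ b c, 0 ≤ M b c) (h1 : ∀ b, ∑ c, M b c = 1)
    (hρ0 : 0 < ρ) (hη : 0 ≤ η) (hρ : ρ ≤ 1 - η) (hS : ∀ b ∈ S, 1 - η ≤ M b b)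
    (hstep : ∀ b ∉ S, ∃ d, ψ d < ψ b ∧ ρ ≤ M b d) {N : ℕ} (hψ : ∀ b, ψ b ≤ N)
    {θ : ℝ} (hθ : 0 < θ) (hθη : N * η ≤ ρ ^ N * θ) :
    ∃ K, ∀ k, K ≤ k → ∀ b, 1 - 2 * θ ≤ ∑ c ∈ S, (M ^ k) b c := by
  set f : ℕ → α → ℝ := fun k b => ∑ c ∈ S, (M ^ k) b c with hf
  have hf0 : ∀ k b, 0 ≤ f k b := fun k b =>
    Finset.sum_nonneg fun c _ => (stochastic_pow h0 h1 k).1 _ _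
  set c : ℝ := ρ ^ N with hc
  have hc0 : 0 < c := pow_pos hρ0 _
  have hc1 : c ≤ 1 := pow_le_one₀ hρ0.le (by linarith)
  have hf1 : ∀ k b, f k b ≤ 1 := fun k b => by
    rw [← (stochastic_pow h0 h1 k).2 b]
    exact Finset.sum_le_sum_of_subset_of_nonneg (Finset.subset_univ _)
      fun i _ _ => (stochastic_pow h0 h1 k).1 _ _
  -- Over `N` steps the probability of being outside `S` contracts by `1 - c`, up to the leakage `N
  -- * η`.
  have hrec : ∀ k b, 1 - f (k + N) b ≤ (1 - c) * (1 - f k b) + N * η := by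
    intro k b
    -- From any state `S` is reached with probability at least `c`; from inside, Bernoulli's
    -- inequality gives `1 - N * η`.
    have hpt : ∀ d, c + (1 - N * η - c) * (if d ∈ S then 1 else 0) ≤ f N d := by
      intro d
      split_ifs with hd
      · have hB : 1 + (N : ℝ) * (-η) ≤ (1 + -η) ^ N :=
          one_add_mul_le_pow (by linarith) N
        have := sum_pow_ge_of_mem h0 h1 (by linarith) hS N hd
        rw [← sub_eq_add_neg] at hB
        simp only [hf]
        linarith
      · have := sum_pow_ge h0 h1 hρ0.le hρ hS hstep N d (hψ d)
        simpa [hf, hc] using this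
    have hsum : c + (1 - N * η - c) * f k b ≤ f (k + N) b := by
      have e : f (k + N) b = ∑ d, (M ^ k) b d * f N d := sum_pow_add k N b
      rw [e]
      calc c + (1 - N * η - c) * f k b
          = ∑ d, (M ^ k) b d * (c + (1 - N * η - c) * (if d ∈ S then 1 else 0)) := by
            simp_rw [mul_add, Finset.sum_add_distrib, ← Finset.sum_mul,
              (stochastic_pow h0 h1 k).2 b, one_mul]
            congr 1
            simp only [hf, Finset.mul_sum, mul_ite, mul_one, mul_zero]
            rw [Finset.sum_ite_mem, Finset.univ_inter]
            exact Finset.sum_congr rfl fun _ _ => mul_comm _ _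
        _ ≤ _ := Finset.sum_le_sum fun d _ =>
            mul_le_mul_of_nonneg_left (hpt d) ((stochastic_pow h0 h1 k).1 _ _)
    have := mul_le_mul_of_nonneg_left (hf1 k b) (by positivity : 0 ≤ N * η)
    nlinarith
  -- The additive error is stable under the recursion: `(1 - c) * θ + N * η ≤ θ` by `hθη`. The
  -- offset `r` serves all times, not only multiples of `N`.
  have hiter : ∀ j r b, 1 - f (r + j * N) b ≤ (1 - c) ^ j + θ := by
    intro j
    induction j with
    | zero => intro r b; simp only [zero_mul, add_zero, pow_zero]; linarith [hf0 r b]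
    | succ j ih =>
      intro r b
      have h := hrec (r + j * N) b
      have h' := mul_le_mul_of_nonneg_left (ih r b) (by linarith : 0 ≤ 1 - c)
      have e : r + (j + 1) * N = r + j * N + N := by ring
      rw [e, pow_succ]
      nlinarith
  obtain ⟨J, hJ⟩ := exists_pow_lt_of_lt_one hθ (by linarith : 1 - c < 1)
  refine ⟨J * N, fun k hk b => ?_⟩
  have := hiter J (k - J * N) b
  rw [Nat.sub_add_cancel hk] at this
  simp only [hf] at this
  linarith

end Stochastic

open ProbabilityTheory

/-! ### Independence of past and future noise -/

section Independence

variable {X : Type*} [MeasurableSpace X]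

/-- For i.i.d. random variables, an event about the first `s` and an event about the following
`L` are independent. -/
lemma measureReal_inter_shift (μ : Measure X) [IsProbabilityMeasure μ] {E F : Set (ℕ → X)}
    (hE : MeasurableSet E) (hF : MeasurableSet F) {s L : ℕ}
    (hEs : ∀ z z' : ℕ → X, (∀ i < s, z i = z' i) → z ∈ E → z' ∈ E)
    (hFL : ∀ z z' : ℕ → X, (∀ i < L, z i = z' i) → z ∈ F → z' ∈ F) :
    (Measure.infinitePi fun _ : ℕ => μ).real (E ∩ {z | (fun i => z (s + i)) ∈ F}) =
      (Measure.infinitePi fun _ : ℕ => μ).real E *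
        (Measure.infinitePi fun _ : ℕ => μ).real F := by
  classical
  set P := Measure.infinitePi fun _ : ℕ => μ with hP
  obtain ⟨x₀⟩ : Nonempty X := by
    by_contra h
    rw [not_nonempty_iff] at h
    have := measure_univ (μ := μ)
    simp [Set.univ_eq_empty_iff.2 h] at this
  have hind : iIndepFun (fun (i : ℕ) (z : ℕ → X) => z i) P :=
    iIndepFun_infinitePi (X := fun _ x => x) fun _ => measurable_id
  have hdis : Disjoint (Finset.range s) (Finset.Ico s (s + L)) := by
    rw [Finset.disjoint_left]
    intro i hi hi'
    simp only [Finset.mem_range, Finset.mem_Ico] at hi hi'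
    omega
  have h2 := hind.indepFun_finset (Finset.range s) (Finset.Ico s (s + L)) hdis
    fun i => measurable_pi_apply i
  -- Padding finite blocks with `x₀` expresses both events through disjoint sets of coordinates; by
  -- `hEs` and `hFL` the padding is immaterial.
  let e₁ : (Finset.range s → X) → ℕ → X := fun y i =>
    if h : i ∈ Finset.range s then y ⟨i, h⟩ else x₀
  let e₂ : (Finset.Ico s (s + L) → X) → ℕ → X := fun y i =>
    if h : s + i ∈ Finset.Ico s (s + L) then y ⟨s + i, h⟩ else x₀
  have he₁ : Measurable e₁ := by
    refine measurable_pi_iff.2 fun i => ?_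
    by_cases h : i ∈ Finset.range s
    · simpa only [e₁, dif_pos h] using measurable_pi_apply _
    · simp only [e₁, dif_neg h]; exact measurable_const
  have he₂ : Measurable e₂ := by
    refine measurable_pi_iff.2 fun i => ?_
    by_cases h : s + i ∈ Finset.Ico s (s + L)
    · simpa only [e₂, dif_pos h] using measurable_pi_apply _
    · simp only [e₂, dif_neg h]; exact measurable_const
  have h3 := (h2.comp he₁ he₂).measure_inter_preimage_eq_mul E F hE hF
  have hE' : (e₁ ∘ fun (z : ℕ → X) (i : Finset.range s) => z i) ⁻¹' E = E := by
    ext z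
    have : ∀ i < s, (e₁ fun i : Finset.range s => z i) i = z i := fun i hi => by
      simp [e₁, hi]
    exact ⟨hEs _ _ this, hEs _ _ fun i hi => (this i hi).symm⟩
  have hF' : (e₂ ∘ fun (z : ℕ → X) (i : Finset.Ico s (s + L)) => z i) ⁻¹' F =
      {z | (fun i => z (s + i)) ∈ F} := by
    ext z
    have : ∀ i < L, (e₂ fun i : Finset.Ico s (s + L) => z i) i = z (s + i) := fun i hi => by
      simp [e₂, hi]
    exact ⟨hFL _ _ this, hFL _ _ fun i hi => (this i hi).symm⟩
  have hsh : Measurable fun (z : ℕ → X) (i : ℕ) => z (s + i) :=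
    measurable_pi_iff.2 fun i => measurable_pi_apply _
  have hmap : P.map (fun (z : ℕ → X) (i : ℕ) => z (s + i)) = P :=
    Measure.map_infinitePi_infinitePi_of_inj (P := fun _ : ℕ => μ) (f := fun i => s + i)
      (add_right_injective s)
  have hF'' : P {z | (fun i => z (s + i)) ∈ F} = P F := by
    conv_rhs => rw [← hmap, Measure.map_apply hsh hF]
    rfl
  rw [hE', hF', hF''] at h3
  rw [measureReal_def, h3, ENNReal.toReal_mul]
  rfl

end Independence

/-! ### Measurability of the algorithm -/

section Measurability

variable {Ω : Type*} [MeasurableSpace Ω]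

lemma measurable_propose {ε : ℝ} {b : Ω → Profile n} {z : Ω → Noise n} (hb : Measurable b)
    (hz : Measurable z) : Measurable fun x => propose ε (b x) (z x) := by
  refine measurable_pi_iff.2 fun m => ?_
  have hzm : Measurable fun x => z x m := (measurable_pi_apply m).comp hz
  refine Measurable.ite (measurableSet_lt ?_ measurable_const) ?_
    ((measurable_pi_apply m).comp hb)
  · exact measurable_subtype_coe.comp (measurable_fst.comp hzm)
  · exact measurable_fst.comp (measurable_snd.comp hzm)

lemma measurable_payoff (𝓜 : Market n) {a : Ω → Profile n} {z : Ω → Noise n}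
    (ha : Measurable a) (hz : Measurable z) (m : Man n) (w : Woman n) :
    Measurable fun x => 𝓜.payoff (a x) (z x) m w := by
  have hzm : Measurable fun x => z x m := (measurable_pi_apply m).comp hz
  refine Measurable.ite ?_ ?_ measurable_const
  · exact ha (Set.toFinite {c : Profile n | c m = w ∧ ∀ k, 𝓜.prefers w k m → c k ≠ w}).measurableSet
  · exact (measurable_pi_apply w).comp
      (measurable_fst.comp (measurable_snd.comp (measurable_snd.comp hzm)))

/-- The set of improving actions and the old baseline take finitely many values, so it is enough to
treat the update for each fixed pair of them. -/
lemma measurable_nextBaseline {δ ω : ℝ} {u : Ω → Woman n → ℝ} {b : Ω → Woman n}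
    {z : Ω → ManNoise n} (hu : Measurable u) (hb : Measurable b) (hz : Measurable z) :
    Measurable fun x => nextBaseline δ ω (u x) (b x) (z x) := by
  let _ : MeasurableSpace (Finset (Woman n)) := ⊤
  have hub : Measurable fun x => u x (b x) := by
    have : Measurable fun q : Woman n × (Woman n → ℝ) => q.2 q.1 :=
      measurable_from_prod_countable_right fun w => measurable_pi_apply w
    exact this.comp (hb.prodMk hu)
  have hA : Measurable fun x => improving δ (u x) (b x) := by
    refine measurable_to_countable' fun A => ?_
    have : (fun x => improving δ (u x) (b x)) ⁻¹' {A} =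
        ⋂ w, {x | u x (b x) + δ ≤ u x w ↔ w ∈ A} := by
      ext x
      simp [improving, Finset.ext_iff]
    rw [this]
    refine MeasurableSet.iInter fun w => ?_
    have hm : MeasurableSet {x | u x (b x) + δ ≤ u x w} :=
      measurableSet_le (hub.add_const δ) ((measurable_pi_apply w).comp hu)
    by_cases hw : w ∈ A
    · simpa only [hw, iff_true] using hm
    · simp only [hw, iff_false]; exact hm.compl
  have hG : Measurable fun q : (Finset (Woman n) × Woman n) × ManNoise n =>
      open Classical in
      if q.1.1.Nonempty ∧ ω ≤ (q.2.inertiaCoin : ℝ) then q.2.pick q.1.1 else q.1.2 := by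
    refine measurable_from_prod_countable_right fun q => ?_
    refine Measurable.ite ?_ ?_ (measurable_const : Measurable fun _ : ManNoise n => q.2)
    · have hi : Measurable fun y : ManNoise n => (y.inertiaCoin : ℝ) :=
        measurable_subtype_coe.comp (measurable_fst.comp
          (measurable_snd.comp (measurable_snd.comp measurable_snd)))
      exact (MeasurableSet.const q.1.Nonempty).inter (measurableSet_le measurable_const hi)
    · exact (measurable_pi_apply q.1).comp (measurable_snd.comp
        (measurable_snd.comp (measurable_snd.comp measurable_snd)))
  exact hG.comp ((hA.prodMk hb).prodMk hz)

end Measurability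

lemma measurable_state (𝓜 : Market n) (τ : Man n → ℕ) (ε δ ω : ℝ) (a : Profile n) (t : ℕ) :
    Measurable (fun z => (state 𝓜 τ ε δ ω (a, z) t).baseline) ∧
      (Measurable fun z => (state 𝓜 τ ε δ ω (a, z) t).count) ∧
      Measurable fun z => (state 𝓜 τ ε δ ω (a, z) t).total := by
  induction t with
  | zero => exact ⟨measurable_const, measurable_const, measurable_const⟩
  | succ t ih =>
    obtain ⟨hb, hc, ht⟩ := ih
    have hz : Measurable fun z : ℕ → Noise n => z t := measurable_pi_apply t
    have ha := measurable_propose (ε := ε) hb hz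
    have hc' : ∀ m w, Measurable fun z => (state 𝓜 τ ε δ ω (a, z) t).count m w +
        if propose ε (state 𝓜 τ ε δ ω (a, z) t).baseline (z t) m = w then 1 else 0 := by
      intro m w
      refine Measurable.add ?_ (Measurable.ite ?_ measurable_const measurable_const)
      · exact (measurable_pi_apply w).comp ((measurable_pi_apply m).comp hc)
      · exact ((measurable_pi_apply m).comp ha) (measurableSet_singleton w)
    have ht' : ∀ m w, Measurable fun z => (state 𝓜 τ ε δ ω (a, z) t).total m w +
        𝓜.payoff (propose ε (state 𝓜 τ ε δ ω (a, z) t).baseline (z t)) (z t) m w := by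
      intro m w
      refine Measurable.add ?_ (measurable_payoff 𝓜 ha hz m w)
      exact (measurable_pi_apply w).comp ((measurable_pi_apply m).comp ht)
    refine ⟨measurable_pi_iff.2 fun m => ?_, measurable_pi_iff.2 fun m =>
      measurable_pi_iff.2 fun w => ?_, measurable_pi_iff.2 fun m =>
      measurable_pi_iff.2 fun w => ?_⟩
    · have hbm := (measurable_pi_apply m).comp hb
      by_cases h : τ m ∣ t + 1
      · simp only [state, step, if_pos h]
        refine measurable_nextBaseline (measurable_pi_iff.2 fun w => ?_) hbm
          ((measurable_pi_apply m).comp hz)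
        exact (ht' m w).div (measurable_from_top.comp (hc' m w))
      · simp only [state, step, if_neg h]; exact hbm
    · by_cases h : τ m ∣ t + 1
      · simp only [state, step, if_pos h]; exact measurable_const
      · simpa only [state, step, if_neg h] using hc' m w
    · by_cases h : τ m ∣ t + 1
      · simp only [state, step, if_pos h]; exact measurable_const
      · simpa only [state, step, if_neg h] using ht' m w

lemma measurable_baseline (𝓜 : Market n) (τ : Man n → ℕ) (ε δ ω : ℝ) (a : Profile n) (t : ℕ) :
    Measurable fun z => baseline 𝓜 τ ε δ ω (a, z) t :=
  (measurable_state 𝓜 τ ε δ ω a t).1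

/-! ### Renewal at the ends of episodes -/

lemma state_congr (𝓜 : Market n) (τ : Man n → ℕ) (ε δ ω : ℝ) (a : Profile n)
    {z z' : ℕ → Noise n} {t : ℕ} (h : ∀ i < t, z i = z' i) :
    state 𝓜 τ ε δ ω (a, z) t = state 𝓜 τ ε δ ω (a, z') t := by
  induction t with
  | zero => rfl
  | succ t ih =>
    simp only [state]
    rw [ih fun i hi => h i (by omega), h t (by omega)]

lemma state_mul (𝓜 : Market n) (L : ℕ) (ε δ ω : ℝ) (a : Profile n)
    (z : ℕ → Noise n) (s : ℕ) :
    state 𝓜 (fun _ => L) ε δ ω (a, z) (s * L) =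
      { baseline := baseline 𝓜 (fun _ => L) ε δ ω (a, z) (s * L)
        count := fun _ _ => 0
        total := fun _ _ => 0 } := by
  -- Tallies are empty at time `0` by initialization, and at any other multiple of `L` because the
  -- preceding step closed an episode.
  rcases h : s * L with _ | t
  · rfl
  · have : L ∣ t + 1 := ⟨s, by rw [← h, mul_comm]⟩
    simp only [baseline, state, step, if_pos this]

/-- At the beginning of an episode the algorithm starts afresh with the current baseline
profile. -/
lemma state_mul_add (𝓜 : Market n) (L : ℕ) (ε δ ω : ℝ) (a : Profile n)
    (z : ℕ → Noise n) (s j : ℕ) :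
    state 𝓜 (fun _ => L) ε δ ω (a, z) (s * L + j) =
      state 𝓜 (fun _ => L) ε δ ω
        (baseline 𝓜 (fun _ => L) ε δ ω (a, z) (s * L), fun i => z (s * L + i)) j := by
  induction j with
  | zero => exact state_mul ..
  | succ j ih =>
    have : L ∣ s * L + j + 1 ↔ L ∣ j + 1 := by
      rw [add_assoc]
      exact (Nat.dvd_add_iff_right ⟨s, by ring⟩).symm
    rw [← add_assoc]
    simp only [state]
    rw [ih]
    simp only [step, this]

lemma measurableSet_baseline_eq (𝓜 : Market n) (τ : Man n → ℕ) (ε δ ω : ℝ) (a c : Profile n)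
    (t : ℕ) : MeasurableSet {z | baseline 𝓜 τ ε δ ω (a, z) t = c} :=
  measurable_baseline 𝓜 τ ε δ ω a t (measurableSet_singleton c)

/-! ### The Markov chain of baseline profiles -/

section Chain

variable [NeZero n]

/-- The law of the random numbers of all time steps. -/
noncomputable abbrev noisePath (𝓜 : Market n) : Measure (ℕ → Noise n) :=
  Measure.infinitePi fun _ : ℕ => noiseLaw 𝓜

/-- The probability that an episode with baseline profile `b` leads to the baseline profile
`c`. -/
noncomputable def transition (𝓜 : Market n) (L : ℕ) (ε δ ω : ℝ) :
    Matrix (Profile n) (Profile n) ℝ := Matrix.of fun b c =>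
  (noisePath 𝓜).real {z | baseline 𝓜 (fun _ => L) ε δ ω (b, z) L = c}

lemma transition_nonneg (𝓜 : Market n) (L : ℕ) (ε δ ω : ℝ) (b c : Profile n) :
    0 ≤ transition 𝓜 L ε δ ω b c := measureReal_nonneg

lemma sum_transition (𝓜 : Market n) (L : ℕ) (ε δ ω : ℝ) (b : Profile n) :
    ∑ c, transition 𝓜 L ε δ ω b c = 1 := by
  have := sum_measureReal_preimage_singleton (μ := noisePath 𝓜) (Finset.univ : Finset (Profile n))
    (f := fun z => baseline 𝓜 (fun _ => L) ε δ ω (b, z) L)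
    (fun c _ => measurableSet_baseline_eq 𝓜 _ ε δ ω b c L)
  rw [Finset.coe_univ, Set.preimage_univ, probReal_univ] at this
  exact this

/-- Conditioning on the baseline profile at time `s`. -/
lemma measureReal_eq_sum_baseline (𝓜 : Market n) (τ : Man n → ℕ) (ε δ ω : ℝ) (a : Profile n)
    (s L : ℕ) {F : Profile n → Set (ℕ → Noise n)} (hF : ∀ b, MeasurableSet (F b))
    (hFL : ∀ b, ∀ z z' : ℕ → Noise n, (∀ i < L, z i = z' i) → z ∈ F b → z' ∈ F b) :
    (noisePath 𝓜).real {z | (fun i => z (s + i)) ∈ F (baseline 𝓜 τ ε δ ω (a, z) s)} =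
      ∑ b, (noisePath 𝓜).real {z | baseline 𝓜 τ ε δ ω (a, z) s = b} *
        (noisePath 𝓜).real (F b) := by
  have hsh : Measurable fun (z : ℕ → Noise n) (i : ℕ) => z (s + i) :=
    measurable_pi_iff.2 fun i => measurable_pi_apply _
  have hset : {z | (fun i => z (s + i)) ∈ F (baseline 𝓜 τ ε δ ω (a, z) s)} =
      ⋃ b ∈ (Finset.univ : Finset (Profile n)), {z | baseline 𝓜 τ ε δ ω (a, z) s = b} ∩
        {z | (fun i => z (s + i)) ∈ F b} := by
    ext z; simp
  rw [hset, measureReal_biUnion_finset]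
  · refine Finset.sum_congr rfl fun b _ => ?_
    refine measureReal_inter_shift _ (measurableSet_baseline_eq ..) (hF b) ?_ (hFL b)
    intro z z' h hz
    simp only [Set.mem_ofPred_eq, baseline] at hz ⊢
    rwa [← state_congr 𝓜 τ ε δ ω a h]
  · intro b _ c _ hbc
    refine Set.disjoint_left.2 fun z hz hz' => hbc ?_
    exact hz.1.symm.trans hz'.1
  · intro b _
    exact (measurableSet_baseline_eq ..).inter (hsh (hF b))

/-- The baseline profiles of the episodes form a Markov chain. -/
lemma measureReal_baseline_mul (𝓜 : Market n) (L : ℕ) (ε δ ω : ℝ) (a : Profile n) (s : ℕ)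
    (c : Profile n) :
    (noisePath 𝓜).real {z | baseline 𝓜 (fun _ => L) ε δ ω (a, z) (s * L) = c} =
      (transition 𝓜 L ε δ ω ^ s) a c := by
  induction s generalizing c with
  | zero =>
    rw [pow_zero, Matrix.one_apply]
    simp only [zero_mul, baseline, state]
    split_ifs with h <;> simp [h]
  | succ s ih =>
    rw [pow_succ, Matrix.mul_apply]
    have := measureReal_eq_sum_baseline 𝓜 (fun _ => L) ε δ ω a (s * L) L
      (F := fun b => {z | baseline 𝓜 (fun _ => L) ε δ ω (b, z) L = c})
      (fun b => measurableSet_baseline_eq ..) (fun b z z' h hz => by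
        simp only [Set.mem_ofPred_eq, baseline] at hz ⊢
        rwa [← state_congr 𝓜 _ ε δ ω b h])
    simp_rw [ih] at this
    refine Eq.trans ?_ this
    congr 1
    ext z
    have h := congrArg State.baseline (state_mul_add 𝓜 L ε δ ω a z s L)
    simp only [Set.mem_ofPred_eq, Nat.succ_mul]
    rw [baseline, h]
    rfl

end Chain

/-! ### Coins and proposal probabilities -/

section UnitInterval

lemma measureReal_coin_lt {ε : ℝ} (h0 : 0 ≤ ε) (h1 : ε ≤ 1) :
    (volume : Measure unitInterval).real {x | (x : ℝ) < ε} = ε := by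
  have : {x : unitInterval | (x : ℝ) < ε} = Set.Iio ⟨ε, h0, h1⟩ := by
    ext x; exact Iff.rfl
  rw [this, measureReal_def, unitInterval.volume_Iio, ENNReal.toReal_ofReal h0]

lemma measurableSet_coin_lt (ε : ℝ) : MeasurableSet {x : unitInterval | (x : ℝ) < ε} :=
  measurableSet_lt measurable_subtype_coe measurable_const

lemma measureReal_le_coin {ε : ℝ} (h0 : 0 ≤ ε) (h1 : ε ≤ 1) :
    (volume : Measure unitInterval).real {x | ε ≤ (x : ℝ)} = 1 - ε := by
  have : {x : unitInterval | ε ≤ (x : ℝ)} = {x : unitInterval | (x : ℝ) < ε}ᶜ := by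
    ext x; simp
  rw [this, probReal_compl_eq_one_sub (measurableSet_coin_lt ε), measureReal_coin_lt h0 h1]

end UnitInterval

/-- The proposal of one man with baseline action `b`. -/
noncomputable def proposeMan (ε : ℝ) (b : Woman n) (x : ManNoise n) : Woman n :=
  if (x.exploreCoin : ℝ) < ε then x.exploreAction else b

lemma propose_apply (ε : ℝ) (b : Profile n) (z : Noise n) (m : Man n) :
    propose ε b z m = proposeMan ε (b m) (z m) := rfl

lemma measurable_proposeMan (ε : ℝ) (b : Woman n) :
    Measurable fun x : ManNoise n => proposeMan ε b x :=
  Measurable.ite ((measurableSet_coin_lt ε).preimage measurable_fst)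
    (measurable_fst.comp measurable_snd) measurable_const

/-- The probability that a man with baseline action `b` proposes to `w`. -/
noncomputable def proposeProb (ε : ℝ) (b w : Woman n) : ℝ :=
  ε * (n : ℝ)⁻¹ + (1 - ε) * if b = w then 1 else 0

lemma integrable_reward (𝓜 : Market n) (m : Man n) (w : Woman n) :
    Integrable (fun r : ℝ => r) (𝓜.rewardLaw m w) :=
  Integrable.of_mem_Icc 0 1 aemeasurable_id (𝓜.rewardLaw_supp m w)

lemma proposeProb_nonneg {ε : ℝ} (h0 : 0 ≤ ε) (h1 : ε ≤ 1) (b w : Woman n) :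
    0 ≤ proposeProb ε b w := by
  unfold proposeProb
  have := sub_nonneg.2 h1
  split_ifs <;> positivity

lemma le_proposeProb {ε : ℝ} (h1 : ε ≤ 1) (b w : Woman n) :
    ε * (n : ℝ)⁻¹ ≤ proposeProb ε b w := by
  unfold proposeProb
  have := sub_nonneg.2 h1
  split_ifs <;> linarith

lemma Market.mean_le_one (𝓜 : Market n) (m : Man n) (w : Woman n) : 𝓜.mean m w ≤ 1 := by
  have := integral_mono_ae (integrable_reward 𝓜 m w) (integrable_const (1 : ℝ))
    ((𝓜.rewardLaw_supp m w).mono fun r hr => hr.2)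
  rw [integral_const, probReal_univ, one_smul] at this
  exact this

/-! ### Expected payoffs in one time step -/

section OneStep

variable [NeZero n]

/-- The law of the random numbers of one man at one time step. -/
noncomputable def manLaw (𝓜 : Market n) (m : Man n) : Measure (ManNoise n) :=
  (volume : Measure unitInterval).prod
    ((PMF.uniformOfFintype (Woman n)).toMeasure.prod
      ((Measure.pi fun w => 𝓜.rewardLaw m w).prod
        ((volume : Measure unitInterval).prod (Measure.pi fun A => pickLaw n A))))

instance (𝓜 : Market n) (m : Man n) : IsProbabilityMeasure (manLaw 𝓜 m) := by
  unfold manLaw; infer_instance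

lemma noiseLaw_eq (𝓜 : Market n) : noiseLaw 𝓜 = Measure.pi (manLaw 𝓜) := rfl

lemma measureReal_uniform_singleton (w : Woman n) :
    (PMF.uniformOfFintype (Woman n)).toMeasure.real {w} = (n : ℝ)⁻¹ := by
  rw [measureReal_def, PMF.toMeasure_apply_singleton _ _ (measurableSet_singleton w),
    PMF.uniformOfFintype_apply]
  simp

lemma inv_le_measureReal_pickLaw {A : Finset (Woman n)} {w : Woman n} (hw : w ∈ A) :
    (n : ℝ)⁻¹ ≤ (pickLaw n A).real {w} := by
  have hA : A.Nonempty := ⟨w, hw⟩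
  rw [measureReal_def, pickLaw, dif_pos hA,
    PMF.toMeasure_apply_singleton _ _ (measurableSet_singleton w),
    PMF.uniformOfFinset_apply_of_mem hA hw]
  rw [ENNReal.toReal_inv, ENNReal.toReal_natCast]
  have h1 : 0 < A.card := hA.card_pos
  have h2 : A.card ≤ n := (Finset.card_le_univ A).trans (by simp)
  exact inv_anti₀ (by exact_mod_cast h1) (by exact_mod_cast h2)

lemma integral_proposeMan_mul (𝓜 : Market n) (m : Man n) {ε : ℝ} (h0 : 0 ≤ ε) (h1 : ε ≤ 1)
    (b w : Woman n)
    {G : (Woman n → ℝ) × unitInterval × (Finset (Woman n) → Woman n) → ℝ}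
    (hG : Integrable G ((Measure.pi fun w => 𝓜.rewardLaw m w).prod
        ((volume : Measure unitInterval).prod (Measure.pi fun A => pickLaw n A)))) :
    ∫ x, (if proposeMan ε b x = w then 1 else 0) * G x.2.2 ∂manLaw 𝓜 m =
      proposeProb ε b w * ∫ y, G y ∂((Measure.pi fun w => 𝓜.rewardLaw m w).prod
        ((volume : Measure unitInterval).prod (Measure.pi fun A => pickLaw n A))) := by
  set ν := (Measure.pi fun w => 𝓜.rewardLaw m w).prod
        ((volume : Measure unitInterval).prod (Measure.pi fun A => pickLaw n A)) with hν
  set A : unitInterval → ℝ := Set.indicator {x | (x : ℝ) < ε} 1 with hA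
  set C : unitInterval → ℝ := Set.indicator {x | (x : ℝ) < ε}ᶜ 1 with hC
  set B : Woman n → ℝ := Set.indicator {w} 1 with hB
  set D : ℝ := if b = w then 1 else 0 with hD
  have hmA := measurableSet_coin_lt ε
  have iA : Integrable A := (integrable_const (1 : ℝ)).indicator hmA
  have iC : Integrable C := (integrable_const (1 : ℝ)).indicator hmA.compl
  have iB : Integrable B (PMF.uniformOfFintype (Woman n)).toMeasure :=
    (integrable_const (1 : ℝ)).indicator (measurableSet_singleton w)
  -- Splitting by the exploration coin makes each summand a product of functions of independent
  -- coordinates.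
  have hpt : ∀ x : ManNoise n, (if proposeMan ε b x = w then 1 else 0) * G x.2.2 =
      A x.1 * (B x.2.1 * G x.2.2) + C x.1 * (D * G x.2.2) := by
    intro x
    by_cases hx : (x.1 : ℝ) < ε
    · have e1 : A x.1 = 1 := Set.indicator_of_mem (s := {x : unitInterval | (x : ℝ) < ε}) hx _
      have e2 : C x.1 = 0 := Set.indicator_of_notMem
        (s := {x : unitInterval | (x : ℝ) < ε}ᶜ) (fun h => h hx) _
      have e3 : proposeMan ε b x = x.2.1 := if_pos hx
      rw [e1, e2, e3, hB, Set.indicator_apply]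
      simp
    · have e1 : A x.1 = 0 := Set.indicator_of_notMem
        (s := {x : unitInterval | (x : ℝ) < ε}) hx _
      have e2 : C x.1 = 1 := Set.indicator_of_mem
        (s := {x : unitInterval | (x : ℝ) < ε}ᶜ) hx _
      have e3 : proposeMan ε b x = b := if_neg hx
      rw [e1, e2, e3, hD]
      simp
  simp_rw [hpt]
  rw [manLaw, integral_add (iA.mul_prod (iB.mul_prod hG))
      (iC.mul_prod (((integrable_const D).mul_prod hG))),
    integral_prod_mul A fun y : Woman n × _ => B y.1 * G y.2,
    integral_prod_mul C fun y : Woman n × _ => D * G y.2, integral_prod_mul B G,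
    integral_prod_mul (fun _ : Woman n => D) G, hA, hB, hC, integral_indicator_one hmA,
    integral_indicator_one hmA.compl, integral_indicator_one (measurableSet_singleton w),
    probReal_compl_eq_one_sub hmA, measureReal_coin_lt h0 h1, measureReal_uniform_singleton]
  simp only [integral_const, probReal_univ, one_smul, proposeProb, hD]
  ring

lemma integral_proposeMan (𝓜 : Market n) (m : Man n) {ε : ℝ} (h0 : 0 ≤ ε) (h1 : ε ≤ 1)
    (b w : Woman n) :
    ∫ x, (if proposeMan ε b x = w then 1 else 0 : ℝ) ∂manLaw 𝓜 m = proposeProb ε b w := by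
  have := integral_proposeMan_mul 𝓜 m h0 h1 b w (G := fun _ => 1) (integrable_const 1)
  simpa using this

lemma integral_proposeMan_mul_reward (𝓜 : Market n) (m : Man n) {ε : ℝ} (h0 : 0 ≤ ε)
    (h1 : ε ≤ 1) (b w : Woman n) :
    ∫ x : ManNoise n, (if proposeMan ε b x = w then 1 else 0) * x.reward w ∂manLaw 𝓜 m =
      proposeProb ε b w * 𝓜.mean m w := by
  have hi : Integrable (fun y : Woman n → ℝ => y w) (Measure.pi fun w => 𝓜.rewardLaw m w) :=
    (measurePreserving_eval (fun w => 𝓜.rewardLaw m w) w).integrable_comp_of_integrable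
      (integrable_reward 𝓜 m w)
  have := integral_proposeMan_mul 𝓜 m h0 h1 b w (G := fun y => y.1 w) (hi.comp_fst _)
  refine this.trans ?_
  rw [integral_fun_fst (fun y : Woman n → ℝ => y w), probReal_univ, one_smul,
    integral_comp_eval (μ := fun w => 𝓜.rewardLaw m w) (i := w) (f := fun r : ℝ => r)
      aestronglyMeasurable_id]
  rfl

/-- The factors of the product formula for the expected payoff. -/
lemma integral_payoff (𝓜 : Market n) {ε : ℝ} (h0 : 0 ≤ ε) (h1 : ε ≤ 1) (b : Profile n)
    (m : Man n) (w : Woman n) :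
    ∫ z, 𝓜.payoff (propose ε b z) z m w ∂noiseLaw 𝓜 =
      proposeProb ε (b m) w * 𝓜.mean m w * ∏ k ∈ Finset.univ.erase m,
        open Classical in if 𝓜.prefers w k m then 1 - proposeProb ε (b k) w else 1 := by
  classical
  -- The payoff is a product of one factor per man, each depending on his own noise only, so its
  -- expectation factorizes.
  let f : Man n → ManNoise n → ℝ := fun k x =>
    if k = m then (if proposeMan ε (b m) x = w then 1 else 0) * x.reward w
    else if 𝓜.prefers w k m then 1 - (if proposeMan ε (b k) x = w then 1 else 0) else 1
  have hpt : ∀ z, 𝓜.payoff (propose ε b z) z m w = ∏ k, f k (z k) := by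
    intro z
    rw [← Finset.mul_prod_erase _ _ (Finset.mem_univ m)]
    have hm : f m (z m) = (if proposeMan ε (b m) (z m) = w then 1 else 0) * (z m).reward w :=
      if_pos rfl
    have hk : ∀ k ∈ Finset.univ.erase m, f k (z k) =
        if 𝓜.prefers w k m → proposeMan ε (b k) (z k) ≠ w then 1 else 0 := by
      intro k hk
      have : k ≠ m := Finset.ne_of_mem_erase hk
      simp only [f, if_neg this]
      by_cases h : 𝓜.prefers w k m <;> by_cases h' : proposeMan ε (b k) (z k) = w <;> simp [h, h']
    rw [hm, Finset.prod_congr rfl hk, Finset.prod_ite_zero]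
    have : (∀ k ∈ Finset.univ.erase m, 𝓜.prefers w k m → proposeMan ε (b k) (z k) ≠ w) ↔
        ∀ k, 𝓜.prefers w k m → propose ε b z k ≠ w := by
      refine ⟨fun h k hk => h k (Finset.mem_erase.2 ⟨fun e => ?_, Finset.mem_univ _⟩) hk,
        fun h k _ => h k⟩
      exact 𝓜.prefers_irrefl w m (e ▸ hk)
    simp only [this, Finset.prod_const_one, Market.payoff, propose_apply ε b z m]
    by_cases h : proposeMan ε (b m) (z m) = w <;>
      by_cases h' : ∀ k, 𝓜.prefers w k m → propose ε b z k ≠ w <;> simp [h, h']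
  simp_rw [hpt]
  rw [noiseLaw_eq, integral_fintype_prod_eq_prod, ← Finset.mul_prod_erase _ _ (Finset.mem_univ m)]
  congr 1
  · simp only [f, if_pos]
    exact integral_proposeMan_mul_reward 𝓜 m h0 h1 (b m) w
  · refine Finset.prod_congr rfl fun k hk => ?_
    have hkm : k ≠ m := Finset.ne_of_mem_erase hk
    simp only [f, if_neg hkm]
    split_ifs with h
    · have hs : MeasurableSet {x : ManNoise n | proposeMan ε (b k) x = w} :=
        measurable_proposeMan ε (b k) (measurableSet_singleton w)
      rw [integral_sub (integrable_const _), integral_proposeMan 𝓜 k h0 h1]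
      · simp
      · exact Integrable.of_mem_Icc 0 1
          (Measurable.ite hs measurable_const measurable_const).aemeasurable
          (Filter.Eventually.of_forall fun x => by split_ifs <;> simp)
    · simp

lemma inv_natCast_le_one : (n : ℝ)⁻¹ ≤ 1 :=
  inv_le_one_of_one_le₀ (by exact_mod_cast NeZero.one_le)

lemma proposeProb_le_one {ε : ℝ} (h0 : 0 ≤ ε) (h1 : ε ≤ 1) (b w : Woman n) :
    proposeProb ε b w ≤ 1 := by
  unfold proposeProb
  have := mul_le_mul_of_nonneg_left (inv_natCast_le_one (n := n)) h0
  split_ifs <;> linarith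

/-- Exploration changes the expected payoff of a proposal by at most `ε`. -/
lemma abs_integral_payoff_sub_le (𝓜 : Market n) {ε : ℝ} (h0 : 0 ≤ ε) (h1 : ε ≤ 1)
    (b : Profile n) (m : Man n) (w : Woman n) :
    |∫ z, 𝓜.payoff (propose ε b z) z m w ∂noiseLaw 𝓜 -
      𝓜.utility b m w * proposeProb ε (b m) w| ≤ ε * proposeProb ε (b m) w := by
  classical
  rw [integral_payoff 𝓜 h0 h1]
  set q := proposeProb ε (b m) w with hq
  have hq0 : 0 ≤ q := proposeProb_nonneg h0 h1 _ _
  set g : Man n → ℝ := fun k => if 𝓜.prefers w k m then 1 - proposeProb ε (b k) w else 1 with hg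
  have hg0 : ∀ k, 0 ≤ g k := fun k => by
    have := proposeProb_le_one h0 h1 (b k) w
    simp only [hg]; split_ifs <;> linarith
  have hg1 : ∀ k, g k ≤ 1 := fun k => by
    have := proposeProb_nonneg h0 h1 (b k) w
    simp only [hg]; split_ifs <;> linarith
  set p := ∏ k ∈ Finset.univ.erase m, g k with hp
  have hp0 : 0 ≤ p := Finset.prod_nonneg fun k _ => hg0 k
  have hp1 : p ≤ 1 := Finset.prod_le_one (fun k _ => hg0 k) fun k _ => hg1 k
  have hμ0 := (𝓜.mean_pos' m w).le
  have hμ1 := 𝓜.mean_le_one m w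
  by_cases hacc : 𝓜.Accepts b m w
  · have hpε : 1 - ε ≤ p := by
      have hn : (0 : ℝ) < n := by exact_mod_cast Nat.pos_of_neZero n
      have hle : (1 - ε * (n : ℝ)⁻¹) ^ n ≤ p := by
        have hx0 : 0 ≤ 1 - ε * (n : ℝ)⁻¹ := by
          have := mul_le_mul_of_nonneg_left (inv_natCast_le_one (n := n)) h0
          linarith
        have hx1 : 1 - ε * (n : ℝ)⁻¹ ≤ 1 := by
          have : 0 ≤ ε * (n : ℝ)⁻¹ := by positivity
          linarith
        calc (1 - ε * (n : ℝ)⁻¹) ^ n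
            ≤ (1 - ε * (n : ℝ)⁻¹) ^ (Finset.univ.erase m).card :=
              pow_le_pow_of_le_one hx0 hx1 ((Finset.card_le_univ _).trans (by simp))
          _ = ∏ k ∈ Finset.univ.erase m, (1 - ε * (n : ℝ)⁻¹) := by rw [Finset.prod_const]
          _ ≤ p := by
              refine Finset.prod_le_prod (fun _ _ => hx0) fun k _ => ?_
              simp only [hg]
              split_ifs with h
              · simp [proposeProb, hacc k h]
              · exact hx1
      have hB : 1 + (n : ℝ) * (-(ε * (n : ℝ)⁻¹)) ≤ (1 + -(ε * (n : ℝ)⁻¹)) ^ n := by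
        refine one_add_mul_le_pow ?_ n
        have := mul_le_mul_of_nonneg_left (inv_natCast_le_one (n := n)) h0
        linarith
      have e : (n : ℝ) * (-(ε * (n : ℝ)⁻¹)) = -ε := by field_simp
      rw [e, ← sub_eq_add_neg, ← sub_eq_add_neg] at hB
      exact hB.trans hle
    rw [Market.utility_of_accepts hacc]
    have e : q * 𝓜.mean m w * p - 𝓜.mean m w * q = -(q * (𝓜.mean m w * (1 - p))) := by ring
    rw [e, abs_neg, abs_of_nonneg (by have := sub_nonneg.2 hp1; positivity), mul_comm ε]
    refine mul_le_mul_of_nonneg_left ?_ hq0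
    calc 𝓜.mean m w * (1 - p) ≤ 1 * (1 - p) :=
          mul_le_mul_of_nonneg_right hμ1 (by linarith)
      _ ≤ ε := by linarith
  · rw [Market.utility_of_not_accepts hacc, zero_mul, sub_zero, abs_of_nonneg (by positivity),
      mul_assoc, mul_comm ε]
    refine mul_le_mul_of_nonneg_left ?_ hq0
    have hc : ∃ k, 𝓜.prefers w k m ∧ b k = w := by
      simpa [Market.Accepts] using hacc
    obtain ⟨k, hk, hkw⟩ := hc
    have hkm : k ∈ Finset.univ.erase m :=
      Finset.mem_erase.2 ⟨fun e => 𝓜.prefers_irrefl w m (e ▸ hk), Finset.mem_univ _⟩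
    -- The preferred rival `k` has baseline `w` and proposes elsewhere with probability at most `ε`.
    have hpk : p ≤ ε := by
      rw [hp, ← Finset.mul_prod_erase _ _ hkm]
      calc g k * ∏ j ∈ (Finset.univ.erase m).erase k, g j ≤ g k * 1 :=
            mul_le_mul_of_nonneg_left
              (Finset.prod_le_one (fun k _ => hg0 k) fun k _ => hg1 k) (hg0 k)
        _ ≤ ε := by
            have : 0 ≤ ε * (n : ℝ)⁻¹ := by positivity
            simp only [hg, if_pos hk, proposeProb, hkw, if_true]
            linarith
    calc 𝓜.mean m w * p ≤ 1 * p := mul_le_mul_of_nonneg_right hμ1 hp0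
      _ ≤ ε := by linarith

end OneStep

/-! ### A weak law of large numbers -/

section Chebyshev

variable {X : Type*} [MeasurableSpace X]

/-- The weak law of large numbers for i.i.d. random variables with values in `[-1, 1]`. -/
lemma measureReal_le_abs_sum_sub_le (μ : Measure X) [IsProbabilityMeasure μ] {g : X → ℝ}
    (hg : Measurable g) (hb : ∀ᵐ x ∂μ, g x ∈ Set.Icc (-1 : ℝ) 1) {L : ℕ} (hL : 0 < L) {r : ℝ}
    (hr : 0 < r) :
    (Measure.infinitePi fun _ : ℕ => μ).real
      {z | r * L ≤ |∑ i ∈ Finset.range L, g (z i) - L * ∫ x, g x ∂μ|} ≤ 1 / (r ^ 2 * L) := by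
  set P := Measure.infinitePi fun _ : ℕ => μ with hP
  have hev : ∀ i, MeasurePreserving (Function.eval i) P μ :=
    measurePreserving_eval_infinitePi fun _ : ℕ => μ
  have hb' : ∀ i, ∀ᵐ z ∂P, g (z i) ∈ Set.Icc (-1 : ℝ) 1 := fun i =>
    (hev i).quasiMeasurePreserving.ae hb
  have hm : ∀ i, Measurable fun z : ℕ → X => g (z i) := fun i => hg.comp (measurable_pi_apply i)
  have hmem : ∀ i, MemLp (fun z : ℕ → X => g (z i)) 2 P := fun i =>
    memLp_of_bounded (hb' i) (hm i).aestronglyMeasurable 2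
  have hind : iIndepFun (fun (i : ℕ) (z : ℕ → X) => g (z i)) P :=
    iIndepFun_infinitePi (X := fun _ => g) fun _ => hg
  set Y : (ℕ → X) → ℝ := ∑ i ∈ Finset.range L, fun z => g (z i) with hY
  have hYm : MemLp Y 2 P := memLp_finsetSum' _ fun i _ => hmem i
  have hvar : variance Y P ≤ L := by
    rw [hY, IndepFun.variance_sum (fun i _ => hmem i) fun i _ j _ hij => hind.indepFun hij]
    calc ∑ i ∈ Finset.range L, variance (fun z : ℕ → X => g (z i)) P
        ≤ ∑ i ∈ Finset.range L, ((1 - (-1)) / 2 : ℝ) ^ 2 :=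
          Finset.sum_le_sum fun i _ => variance_le_sq_of_bounded (hb' i) (hm i).aemeasurable
      _ = L := by norm_num
  have hint : ∫ z, Y z ∂P = L * ∫ x, g x ∂μ := by
    simp only [hY, Finset.sum_apply]
    rw [integral_finsetSum _ fun i _ => (hmem i).integrable (by norm_num)]
    have : ∀ i ∈ Finset.range L, ∫ z, g (z i) ∂P = ∫ x, g x ∂μ := by
      intro i _
      rw [← (hev i).map_eq, integral_map (hev i).measurable.aemeasurable
        hg.aestronglyMeasurable]
    rw [Finset.sum_congr rfl this]
    simp
  have hL' : (0 : ℝ) < L := by exact_mod_cast hL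
  have hc : 0 < r * L := by positivity
  have h := meas_ge_le_variance_div_sq hYm hc
  rw [hint] at h
  have h' := ENNReal.toReal_mono ENNReal.ofReal_ne_top h
  rw [ENNReal.toReal_ofReal (div_nonneg (variance_nonneg _ _) (sq_nonneg _))] at h'
  have hset : {z | r * L ≤ |∑ i ∈ Finset.range L, g (z i) - L * ∫ x, g x ∂μ|} =
      {z | r * L ≤ |Y z - L * ∫ x, g x ∂μ|} := by
    ext z; simp [hY]
  rw [hset, measureReal_def]
  refine h'.trans ?_
  calc variance Y P / (r * L) ^ 2 ≤ L / (r * L) ^ 2 := by gcongr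
    _ = 1 / (r ^ 2 * L) := by field_simp

end Chebyshev

/-! ### One episode -/

/-- How often `m` proposes to `w` at the times before `t` if the baseline profile is `b`. -/
noncomputable def tallyCount (ε : ℝ) (b : Profile n) (z : ℕ → Noise n) (t : ℕ) (m : Man n)
    (w : Woman n) : ℕ :=
  ∑ i ∈ Finset.range t, if propose ε b (z i) m = w then 1 else 0

/-- The rewards that `m` receives from `w` before `t` if the baseline profile is `b`. -/
noncomputable def tallyTotal (𝓜 : Market n) (ε : ℝ) (b : Profile n) (z : ℕ → Noise n) (t : ℕ)
    (m : Man n) (w : Woman n) : ℝ :=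
  ∑ i ∈ Finset.range t, 𝓜.payoff (propose ε b (z i)) (z i) m w

lemma state_of_lt (𝓜 : Market n) {L : ℕ} (ε δ ω : ℝ) (b : Profile n) (z : ℕ → Noise n) {t : ℕ}
    (ht : t < L) :
    state 𝓜 (fun _ => L) ε δ ω (b, z) t =
      { baseline := b, count := tallyCount ε b z t, total := tallyTotal 𝓜 ε b z t } := by
  induction t with
  | zero =>
    simp only [state, State.mk.injEq, true_and]
    constructor <;> ext m w <;> simp [tallyCount, tallyTotal]
  | succ t ih =>
    have h : ¬ L ∣ t + 1 := fun h => (Nat.le_of_dvd (by omega) h).not_gt ht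
    simp only [state]
    rw [ih (by omega)]
    simp only [step, if_neg h, State.mk.injEq, true_and]
    constructor <;> ext m w <;> simp only [tallyCount, tallyTotal, Finset.sum_range_succ]

lemma baseline_episode (𝓜 : Market n) {L : ℕ} (hL : 0 < L) (ε δ ω : ℝ) (b : Profile n)
    (z : ℕ → Noise n) :
    baseline 𝓜 (fun _ => L) ε δ ω (b, z) L = fun m =>
      nextBaseline δ ω (fun w => tallyTotal 𝓜 ε b z L m w / (tallyCount ε b z L m w : ℝ)) (b m)
        (z (L - 1) m) := by
  -- The closing step at time `L - 1` still enters the tallies, and its noise also decides the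
  -- update.
  obtain ⟨l, rfl⟩ : ∃ l, L = l + 1 := ⟨L - 1, by omega⟩
  simp only [baseline, state]
  rw [state_of_lt 𝓜 ε δ ω b z (Nat.lt_succ_self l)]
  simp only [step, dvd_refl, if_true, Nat.add_sub_cancel]
  ext m : 1
  simp only [tallyCount, tallyTotal, Finset.sum_range_succ]

/-- The average rewards are close to their expectations without exploration. -/
def accurate (𝓜 : Market n) (ε : ℝ) (L : ℕ) (b : Profile n) : Set (ℕ → Noise n) :=
  {z | ∀ m w, |tallyTotal 𝓜 ε b z L m w / (tallyCount ε b z L m w : ℝ) - 𝓜.utility b m w| < 2 * ε}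

lemma Market.bddBelow_gap (𝓜 : Market n) :
    BddBelow ({x | ∃ m w, x = 𝓜.mean m w} ∪
      {x | ∃ m w w', w ≠ w' ∧ x = |𝓜.mean m w - 𝓜.mean m w'|}) := by
  refine ⟨0, ?_⟩
  rintro x (⟨m, w, rfl⟩ | ⟨m, w, w', -, rfl⟩)
  exacts [(𝓜.mean_pos' m w).le, abs_nonneg _]

lemma Market.gap_le_mean (𝓜 : Market n) (m : Man n) (w : Woman n) : 𝓜.gap ≤ 𝓜.mean m w :=
  csInf_le 𝓜.bddBelow_gap (Or.inl ⟨m, w, rfl⟩)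

lemma Market.gap_le_abs (𝓜 : Market n) (m : Man n) {w w' : Woman n} (h : w ≠ w') :
    𝓜.gap ≤ |𝓜.mean m w - 𝓜.mean m w'| :=
  csInf_le 𝓜.bddBelow_gap (Or.inr ⟨m, w, w', h, rfl⟩)

/-- The larger utility is positive, hence a true mean; the smaller is another mean or `0`. Either
way the difference is among the numbers bounded by the gap. -/
lemma Market.gap_le_utility_sub (𝓜 : Market n) {b : Profile n} {m : Man n} {w w' : Woman n}
    (h : 𝓜.utility b m w < 𝓜.utility b m w') :
    𝓜.gap ≤ 𝓜.utility b m w' - 𝓜.utility b m w := by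
  have hacc : 𝓜.Accepts b m w' :=
    Market.accepts_of_utility_pos ((𝓜.utility_nonneg _ _ _).trans_lt h)
  rw [Market.utility_of_accepts hacc] at h ⊢
  by_cases hw : 𝓜.Accepts b m w
  · rw [Market.utility_of_accepts hw] at h ⊢
    have hne : w' ≠ w := by rintro rfl; exact lt_irrefl _ h
    have := 𝓜.gap_le_abs m hne
    rwa [abs_of_pos (sub_pos.2 h)] at this
  · rw [Market.utility_of_not_accepts hw, sub_zero]
    exact 𝓜.gap_le_mean m w'

/-- If the averages are accurate, exactly the better replies look better. -/
lemma improving_eq_betterReplies {𝓜 : Market n} {ε δ : ℝ} {L : ℕ} {b : Profile n}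
    {z : ℕ → Noise n} (hδ : 4 * ε ≤ δ) (hgap : 4 * ε ≤ 𝓜.gap - δ)
    (hz : z ∈ accurate 𝓜 ε L b) (m : Man n) :
    improving δ (fun w => tallyTotal 𝓜 ε b z L m w / (tallyCount ε b z L m w : ℝ)) (b m) =
      𝓜.betterReplies b m := by
  ext w
  have h1 := abs_lt.1 (hz m w)
  have h2 := abs_lt.1 (hz m (b m))
  simp only [improving, Finset.mem_filter, Finset.mem_univ, true_and, Market.mem_betterReplies]
  constructor
  -- Two estimation errors cost less than `4 * ε`: here this is at most `δ`, in the converse at most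
  -- `gap - δ`.
  · intro h
    linarith
  · intro h
    have := 𝓜.gap_le_utility_sub h
    linarith

lemma baseline_episode_of_isNash {𝓜 : Market n} {L : ℕ} (hL : 0 < L) {ε δ : ℝ} (ω : ℝ)
    {b : Profile n} (hδ : 4 * ε ≤ δ) (hgap : 4 * ε ≤ 𝓜.gap - δ) (hb : 𝓜.IsNash b)
    {z : ℕ → Noise n} (hz : z ∈ accurate 𝓜 ε L b) :
    baseline 𝓜 (fun _ => L) ε δ ω (b, z) L = b := by
  rw [baseline_episode 𝓜 hL]
  ext m : 1
  rw [nextBaseline, improving_eq_betterReplies hδ hgap hz, hb m]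
  simp

open Classical in
/-- The random numbers of the time step that ends an episode make man `m` accept his better reply
`w` and the other men stay. -/
def movesOnly (𝓜 : Market n) (ω : ℝ) (b : Profile n) (m : Man n) (w : Woman n) :
    Set (Noise n) :=
  Set.univ.pi fun k => if k = m then
    {x | ω ≤ (x.inertiaCoin : ℝ) ∧ x.pick (𝓜.betterReplies b m) = w}
    else {x | (x.inertiaCoin : ℝ) < ω}

lemma baseline_episode_of_movesOnly {𝓜 : Market n} {L : ℕ} (hL : 0 < L) {ε δ ω : ℝ}
    {b : Profile n} (hδ : 4 * ε ≤ δ) (hgap : 4 * ε ≤ 𝓜.gap - δ) {m : Man n} {w : Woman n}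
    (hw : w ∈ 𝓜.betterReplies b m) {z : ℕ → Noise n} (hz : z ∈ accurate 𝓜 ε L b)
    (hz' : z (L - 1) ∈ movesOnly 𝓜 ω b m w) :
    baseline 𝓜 (fun _ => L) ε δ ω (b, z) L = Function.update b m w := by
  rw [baseline_episode 𝓜 hL]
  ext k : 1
  rw [nextBaseline, improving_eq_betterReplies hδ hgap hz]
  have hk := hz' k (Set.mem_univ k)
  beta_reduce at hk
  by_cases hkm : k = m
  · subst hkm
    rw [if_pos rfl] at hk
    rw [if_pos ⟨⟨w, hw⟩, hk.1⟩, Function.update_self]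
    exact hk.2
  · rw [if_neg hkm] at hk
    rw [if_neg fun h => h.2.not_gt hk, Function.update_of_ne hkm]

lemma Market.payoff_mem (𝓜 : Market n) {z : Noise n}
    (hz : ∀ m w, (z m).reward w ∈ Set.Icc (0 : ℝ) 1) (a : Profile n) (m : Man n) (w : Woman n) :
    0 ≤ 𝓜.payoff a z m w ∧ 𝓜.payoff a z m w ≤ if a m = w then 1 else 0 := by
  unfold Market.payoff
  split_ifs with h1 h2 h2
  · exact hz m w
  · exact absurd h1.1 h2
  · exact ⟨le_rfl, zero_le_one⟩
  · exact ⟨le_rfl, le_rfl⟩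

lemma measurable_proposesTo (ε : ℝ) (b : Profile n) (m : Man n) (w : Woman n) :
    Measurable fun z : Noise n => if propose ε b z m = w then (1 : ℝ) else 0 :=
  Measurable.ite (((measurable_pi_apply m).comp (measurable_propose measurable_const
    measurable_id)) (measurableSet_singleton w)) measurable_const measurable_const

/-! ### Accuracy of the averages of an episode -/

section Accuracy

variable [NeZero n]

lemma ae_reward_mem (𝓜 : Market n) :
    ∀ᵐ z ∂noiseLaw 𝓜, ∀ m w, (z m).reward w ∈ Set.Icc (0 : ℝ) 1 := by
  rw [ae_all_iff]
  intro m
  rw [ae_all_iff]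
  intro w
  rw [noiseLaw_eq]
  have h1 := (Measure.quasiMeasurePreserving_eval (fun w => 𝓜.rewardLaw m w) w).ae
    (𝓜.rewardLaw_supp m w)
  exact (Measure.quasiMeasurePreserving_eval (manLaw 𝓜) m).ae
    (Measure.quasiMeasurePreserving_snd.ae (Measure.quasiMeasurePreserving_snd.ae
      (Measure.quasiMeasurePreserving_fst.ae h1)))

lemma integral_proposesTo (𝓜 : Market n) {ε : ℝ} (h0 : 0 ≤ ε) (h1 : ε ≤ 1) (b : Profile n)
    (m : Man n) (w : Woman n) :
    ∫ z, (if propose ε b z m = w then (1 : ℝ) else 0) ∂noiseLaw 𝓜 = proposeProb ε (b m) w := by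
  have hm : Measurable fun x : ManNoise n => if proposeMan ε (b m) x = w then (1 : ℝ) else 0 :=
    Measurable.ite (measurable_proposeMan ε (b m) (measurableSet_singleton w)) measurable_const
      measurable_const
  rw [← integral_proposeMan 𝓜 m h0 h1, noiseLaw_eq,
    ← integral_comp_eval (μ := manLaw 𝓜) (i := m) hm.aestronglyMeasurable]
  rfl

/-- The averages of one man for one woman are accurate with high probability. -/
lemma measureReal_inaccurate_le (𝓜 : Market n) {ε : ℝ} (h0 : 0 < ε) (h1 : ε ≤ 1) {L : ℕ}
    (hL : 0 < L) (b : Profile n) (m : Man n) (w : Woman n) :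
    (noisePath 𝓜).real {z | 2 * ε ≤
        |tallyTotal 𝓜 ε b z L m w / (tallyCount ε b z L m w : ℝ) - 𝓜.utility b m w|} ≤
      2 * (1 / ((ε ^ 2 / (4 * n)) ^ 2 * L)) := by
  have hn : (1 : ℝ) ≤ n := by exact_mod_cast NeZero.one_le
  set r : ℝ := ε ^ 2 / (4 * n) with hr
  have hr0 : 0 < r := by positivity
  have hL' : (0 : ℝ) < L := by exact_mod_cast hL
  set u := 𝓜.utility b m w with hu
  have hu0 : 0 ≤ u := 𝓜.utility_nonneg b m w
  have hu1 : u ≤ 1 := (𝓜.utility_le_mean b m w).trans (𝓜.mean_le_one m w)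
  set c : Noise n → ℝ := fun z => if propose ε b z m = w then 1 else 0 with hc
  set y : Noise n → ℝ := fun z => 𝓜.payoff (propose ε b z) z m w with hy
  have hcm : Measurable c := measurable_proposesTo ε b m w
  have hym : Measurable y :=
    measurable_payoff 𝓜 (measurable_propose measurable_const measurable_id) measurable_id m w
  have hc01 : ∀ z, 0 ≤ c z ∧ c z ≤ 1 := fun z => by
    simp only [hc]; split_ifs <;> norm_num
  have hy01 : ∀ᵐ z ∂noiseLaw 𝓜, 0 ≤ y z ∧ y z ≤ c z :=
    (ae_reward_mem 𝓜).mono fun z hz => 𝓜.payoff_mem hz _ m w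
  set q := proposeProb ε (b m) w with hq
  have hcint : ∫ z, c z ∂noiseLaw 𝓜 = q := integral_proposesTo 𝓜 h0.le h1 b m w
  have hci : Integrable c (noiseLaw 𝓜) :=
    Integrable.of_mem_Icc 0 1 hcm.aemeasurable (Filter.Eventually.of_forall hc01)
  have hyi : Integrable y (noiseLaw 𝓜) :=
    Integrable.of_mem_Icc 0 1 hym.aemeasurable
      (hy01.mono fun z hz => ⟨hz.1, hz.2.trans (hc01 z).2⟩)
  -- Centering the payoff by `u * c` turns the error of the ratio `T / C` into the i.i.d. sum `T - u
  -- * C`, whose drift is at most `ε * q` per step.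
  set d := ∫ z, (y z - u * c z) ∂noiseLaw 𝓜 with hd
  have hdq : |d| ≤ ε * q := by
    rw [hd, integral_sub hyi (hci.const_mul u), integral_const_mul, hcint]
    exact abs_integral_payoff_sub_le 𝓜 h0.le h1 b m w
  have B1 := measureReal_le_abs_sum_sub_le (noiseLaw 𝓜) (g := fun z => y z - u * c z)
    (hym.sub (hcm.const_mul u)) (hy01.mono fun z hz => by
      have h2 := hc01 z
      have h3 := mul_le_mul_of_nonneg_right hu1 h2.1
      have h4 := mul_nonneg hu0 h2.1
      constructor <;> linarith) hL hr0
  have B2 := measureReal_le_abs_sum_sub_le (noiseLaw 𝓜) (g := c) hcm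
    (Filter.Eventually.of_forall fun z => ⟨by linarith [(hc01 z).1], (hc01 z).2⟩) hL hr0
  rw [← hd] at B1
  rw [hcint] at B2
  refine (measureReal_mono ?_).trans ((measureReal_union_le _ _).trans
    ((add_le_add B1 B2).trans_eq (by ring)))
  intro z hz
  by_contra hcon
  rw [Set.mem_union, not_or] at hcon
  have k1 : |∑ i ∈ Finset.range L, (y (z i) - u * c (z i)) - L * d| < r * L := not_le.1 hcon.1
  have k2 : |∑ i ∈ Finset.range L, c (z i) - L * q| < r * L := not_le.1 hcon.2
  have hz' : 2 * ε ≤ |tallyTotal 𝓜 ε b z L m w / (tallyCount ε b z L m w : ℝ) - u| := hz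
  have eT : tallyTotal 𝓜 ε b z L m w = ∑ i ∈ Finset.range L, y (z i) := rfl
  have eC : (tallyCount ε b z L m w : ℝ) = ∑ i ∈ Finset.range L, c (z i) := by
    simp [tallyCount, hc]
  rw [eT, eC] at hz'
  rw [Finset.sum_sub_distrib, ← Finset.mul_sum] at k1
  set T := ∑ i ∈ Finset.range L, y (z i)
  set C := ∑ i ∈ Finset.range L, c (z i)
  have hqε : ε * (n : ℝ)⁻¹ ≤ q := le_proposeProb h1 _ _
  -- This explains the choice of `r`: since `q ≥ ε / n`, one has `4 * r ≤ ε * q`, while `1 + 2 * ε ≤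
  -- 3`.
  have hrq : r * (1 + 2 * ε) < ε * q := by
    have e : r = ε * (ε * (n : ℝ)⁻¹) / 4 := by rw [hr]; field_simp
    have hpos : 0 < ε * (ε * (n : ℝ)⁻¹) := by positivity
    have h2 : ε * (ε * (n : ℝ)⁻¹) ≤ ε * q := mul_le_mul_of_nonneg_left hqε h0.le
    have h3 := mul_le_mul_of_nonneg_left h1 hr0.le
    linarith
  have hCpos : (q - r) * L < C := by
    have := (abs_lt.1 k2).1
    linarith
  have hqr : 0 < q - r := by
    have : r < q := by
      have : ε * q ≤ 1 * q :=
        mul_le_mul_of_nonneg_right h1 (proposeProb_nonneg h0.le h1 _ _)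
      have : 0 ≤ r * (2 * ε) := by positivity
      linarith
    linarith
  have hC0 : 0 < C := (by positivity : 0 < (q - r) * L).trans hCpos
  -- Fluctuation plus drift is at most `(r + ε * q) * L`, which `hrq` puts below `2 * ε * (q - r) *
  -- L`, hence below `2 * ε * C`.
  have hTC : |T - u * C| < 2 * ε * C := by
    have k3 : |T - u * C| ≤ |T - u * C - L * d| + |L * d| := by
      have := abs_add_le (T - u * C - L * d) (L * d)
      simpa using this
    rw [abs_mul, abs_of_pos hL'] at k3
    have k4 := mul_le_mul_of_nonneg_left hdq hL'.le
    have k5 : 2 * ε * ((q - r) * L) < 2 * ε * C := mul_lt_mul_of_pos_left hCpos (by linarith)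
    have k6 := mul_lt_mul_of_pos_right hrq hL'
    linarith
  have : |T / C - u| < 2 * ε := by
    have e : T / C - u = (T - u * C) / C := by field_simp
    rw [e, abs_div, abs_of_pos hC0, div_lt_iff₀ hC0]
    exact hTC
  linarith

/-- Union bound over the `n ^ 2` pairs, each contributing `32 * n ^ 2 / (ε ^ 4 * L)`. -/
lemma measureReal_compl_accurate_le (𝓜 : Market n) {ε : ℝ} (h0 : 0 < ε) (h1 : ε ≤ 1) {L : ℕ}
    (hL : 0 < L) (b : Profile n) :
    (noisePath 𝓜).real (accurate 𝓜 ε L b)ᶜ ≤ 32 * n ^ 4 / ε ^ 4 / L := by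
  have hn : (0 : ℝ) < n := by exact_mod_cast Nat.pos_of_neZero n
  have hsub : (accurate 𝓜 ε L b)ᶜ ⊆ ⋃ q : Man n × Woman n, {z | 2 * ε ≤
        |tallyTotal 𝓜 ε b z L q.1 q.2 / (tallyCount ε b z L q.1 q.2 : ℝ) -
          𝓜.utility b q.1 q.2|} := by
    intro z hz
    have : ¬ ∀ m w, |tallyTotal 𝓜 ε b z L m w / (tallyCount ε b z L m w : ℝ) -
      𝓜.utility b m w| < 2 * ε := hz
    push Not at this
    obtain ⟨m, w, h⟩ := this
    exact Set.mem_iUnion.2 ⟨(m, w), h⟩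
  refine (measureReal_mono hsub).trans ((measureReal_iUnion_fintype_le _).trans
    ((Finset.sum_le_sum fun q _ => measureReal_inaccurate_le 𝓜 h0 h1 hL b q.1 q.2).trans ?_))
  rw [Finset.sum_const, nsmul_eq_mul]
  simp only [Finset.card_univ, Fintype.card_prod, Fintype.card_fin, Nat.cast_mul]
  have hL' : (0 : ℝ) < L := by exact_mod_cast hL
  apply le_of_eq
  field_simp
  ring

end Accuracy

/-! ### Measurability of decisions and proposals -/

lemma measurableSet_inertia (ω : ℝ) :
    MeasurableSet {x : ManNoise n | (x.inertiaCoin : ℝ) < ω} :=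
  (measurableSet_coin_lt ω).preimage
    (measurable_fst.comp (measurable_snd.comp (measurable_snd.comp measurable_snd)))

lemma baseline_eq_baseline_div (𝓜 : Market n) {L : ℕ} (hL : 0 < L) (ε δ ω : ℝ) (a : Profile n)
    (z : ℕ → Noise n) (t : ℕ) :
    baseline 𝓜 (fun _ => L) ε δ ω (a, z) t =
      baseline 𝓜 (fun _ => L) ε δ ω (a, z) (t / L * L) := by
  have h := state_mul_add 𝓜 L ε δ ω a z (t / L) (t % L)
  rw [Nat.div_add_mod', state_of_lt 𝓜 ε δ ω _ _ (Nat.mod_lt t hL)] at h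
  rw [baseline, h]

lemma measurable_proposal (𝓜 : Market n) (τ : Man n → ℕ) (ε δ ω : ℝ) (t : ℕ) :
    Measurable fun x : SampleSpace n =>
      (proposal 𝓜 τ ε δ ω x t, baseline 𝓜 τ ε δ ω x t) := by
  refine measurable_from_prod_countable_right fun a => ?_
  exact (measurable_propose (measurable_baseline 𝓜 τ ε δ ω a t)
    (measurable_pi_apply t)).prodMk (measurable_baseline 𝓜 τ ε δ ω a t)

lemma measurableSet_pick (A : Finset (Woman n)) (w : Woman n) :
    MeasurableSet {f : Finset (Woman n) → Woman n | f A = w} :=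
  (measurable_pi_apply A : Measurable fun f : Finset (Woman n) → Woman n => f A)
    (measurableSet_singleton w)

lemma measurableSet_le_coin (ω : ℝ) : MeasurableSet {c : unitInterval | ω ≤ (c : ℝ)} :=
  measurableSet_le measurable_const measurable_subtype_coe

lemma measurableSet_accept (ω : ℝ) (A : Finset (Woman n)) (w : Woman n) :
    MeasurableSet {x : ManNoise n | ω ≤ (x.inertiaCoin : ℝ) ∧ x.pick A = w} :=
  ((measurableSet_le_coin ω).prod (measurableSet_pick A w)).preimage
    (measurable_snd.comp (measurable_snd.comp measurable_snd))

lemma measurableSet_movesOnly (𝓜 : Market n) (ω : ℝ) (b : Profile n) (m : Man n) (w : Woman n) :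
    MeasurableSet (movesOnly 𝓜 ω b m w) := by
  refine MeasurableSet.univ_pi fun k => ?_
  split_ifs
  · exact measurableSet_accept ω _ w
  · exact measurableSet_inertia ω

/-! ### Transition probabilities and proposal probabilities -/

section Convergence

variable [NeZero n]

lemma measureReal_noiseLaw_pi (𝓜 : Market n) (s : Man n → Set (ManNoise n)) :
    (noiseLaw 𝓜).real (Set.univ.pi s) = ∏ k, (manLaw 𝓜 k).real (s k) := by
  rw [noiseLaw_eq, measureReal_def, Measure.pi_pi, ENNReal.toReal_prod]
  rfl

lemma measureReal_noisePath_eval (𝓜 : Market n) (i : ℕ) {s : Set (Noise n)}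
    (hs : MeasurableSet s) : (noisePath 𝓜).real {z | z i ∈ s} = (noiseLaw 𝓜).real s := by
  have := (measurePreserving_eval_infinitePi (fun _ : ℕ => noiseLaw 𝓜) i).measure_preimage
    hs.nullMeasurableSet
  rw [measureReal_def, measureReal_def, ← this]
  rfl

lemma measurePreserving_decision (𝓜 : Market n) (m : Man n) :
    MeasurePreserving (fun x : ManNoise n => x.2.2.2) (manLaw 𝓜 m)
      ((volume : Measure unitInterval).prod (Measure.pi fun A => pickLaw n A)) :=
  measurePreserving_snd.comp (measurePreserving_snd.comp measurePreserving_snd)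

lemma measureReal_inertia (𝓜 : Market n) (m : Man n) {ω : ℝ} (h0 : 0 ≤ ω) (h1 : ω ≤ 1) :
    (manLaw 𝓜 m).real {x | (x.inertiaCoin : ℝ) < ω} = ω := by
  have := (measurePreserving_fst.comp (measurePreserving_decision 𝓜 m)).measure_preimage
    (measurableSet_coin_lt ω).nullMeasurableSet
  conv_rhs => rw [← measureReal_coin_lt h0 h1]
  rw [measureReal_def, measureReal_def, ← this]
  rfl

lemma le_measureReal_accept (𝓜 : Market n) (m : Man n) {ω : ℝ} (h0 : 0 ≤ ω) (h1 : ω ≤ 1)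
    {A : Finset (Woman n)} {w : Woman n} (hw : w ∈ A) :
    (1 - ω) * (n : ℝ)⁻¹ ≤
      (manLaw 𝓜 m).real {x | ω ≤ (x.inertiaCoin : ℝ) ∧ x.pick A = w} := by
  have h := (measurePreserving_decision 𝓜 m).measure_preimage
    ((measurableSet_le_coin ω).prod (measurableSet_pick A w)).nullMeasurableSet
  have h2 := (measurePreserving_eval (fun A => pickLaw n A) A).measure_preimage
    (measurableSet_singleton w).nullMeasurableSet
  have e : (manLaw 𝓜 m).real {x | ω ≤ (x.inertiaCoin : ℝ) ∧ x.pick A = w} =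
      (1 - ω) * (pickLaw n A).real {w} := by
    rw [Measure.prod_prod] at h
    rw [← measureReal_le_coin h0 h1, measureReal_def, measureReal_def, measureReal_def, ← h2,
      ← ENNReal.toReal_mul]
    exact congrArg ENNReal.toReal h
  rw [e]
  exact mul_le_mul_of_nonneg_left (inv_le_measureReal_pickLaw hw) (by linarith)

/-- The men decide independently: a staying man contributes `ω`, the mover at least `(1 - ω) / n`.
The bound does not depend on the market or the profile. -/
lemma pow_le_measureReal_movesOnly (𝓜 : Market n) {ω : ℝ} (h0 : 0 ≤ ω) (h1 : ω ≤ 1)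
    {b : Profile n} {m : Man n} {w : Woman n} (hw : w ∈ 𝓜.betterReplies b m) :
    (min ω ((1 - ω) * (n : ℝ)⁻¹)) ^ n ≤ (noiseLaw 𝓜).real (movesOnly 𝓜 ω b m w) := by
  rw [movesOnly, measureReal_noiseLaw_pi]
  have hκ : 0 ≤ min ω ((1 - ω) * (n : ℝ)⁻¹) := by
    have := sub_nonneg.2 h1
    exact le_min h0 (by positivity)
  calc (min ω ((1 - ω) * (n : ℝ)⁻¹)) ^ n
      = ∏ _k : Man n, min ω ((1 - ω) * (n : ℝ)⁻¹) := by simp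
    _ ≤ _ := by
      refine Finset.prod_le_prod (fun _ _ => hκ) fun k _ => ?_
      split_ifs with h
      · exact (min_le_right _ _).trans (le_measureReal_accept 𝓜 k h0 h1 hw)
      · rw [measureReal_inertia 𝓜 k h0 h1]
        exact min_le_left _ _

section Transition

variable {𝓜 : Market n} {L : ℕ} {ε δ ω : ℝ} {b : Profile n}

lemma one_sub_le_transition_self (hL : 0 < L) (h0 : 0 < ε) (h1 : ε ≤ 1) (hδ : 4 * ε ≤ δ)
    (hgap : 4 * ε ≤ 𝓜.gap - δ) (hb : 𝓜.IsNash b) :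
    1 - 32 * n ^ 4 / ε ^ 4 / L ≤ transition 𝓜 L ε δ ω b b := by
  have hm := measurableSet_baseline_eq 𝓜 (fun _ => L) ε δ ω b b L
  have hsub : {z | baseline 𝓜 (fun _ => L) ε δ ω (b, z) L = b}ᶜ ⊆ (accurate 𝓜 ε L b)ᶜ :=
    Set.compl_subset_compl.2 fun z hz => baseline_episode_of_isNash hL ω hδ hgap hb hz
  have h := (measureReal_mono (μ := noisePath 𝓜) hsub).trans
    (measureReal_compl_accurate_le 𝓜 h0 h1 hL b)
  rw [probReal_compl_eq_one_sub hm] at h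
  simp only [transition, Matrix.of_apply]
  linarith

/-- Accuracy and the final decision share the noise of time `L - 1`; subtracting the probability of
inaccuracy makes their independence unnecessary. -/
lemma sub_le_transition_update (hL : 0 < L) (h0 : 0 < ε) (h1 : ε ≤ 1) (hδ : 4 * ε ≤ δ)
    (hgap : 4 * ε ≤ 𝓜.gap - δ) (hω0 : 0 ≤ ω) (hω1 : ω ≤ 1) {m : Man n} {w : Woman n}
    (hw : w ∈ 𝓜.betterReplies b m) :
    (min ω ((1 - ω) * (n : ℝ)⁻¹)) ^ n - 32 * n ^ 4 / ε ^ 4 / L ≤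
      transition 𝓜 L ε δ ω b (Function.update b m w) := by
  have h2 : {z : ℕ → Noise n | z (L - 1) ∈ movesOnly 𝓜 ω b m w} ⊆
      {z | baseline 𝓜 (fun _ => L) ε δ ω (b, z) L = Function.update b m w} ∪
        (accurate 𝓜 ε L b)ᶜ := by
    intro z hz
    by_cases hacc : z ∈ accurate 𝓜 ε L b
    · exact Or.inl (baseline_episode_of_movesOnly hL hδ hgap hw hacc hz)
    · exact Or.inr hacc
  have h3 := (measureReal_mono (μ := noisePath 𝓜) h2).trans (measureReal_union_le _ _)
  rw [measureReal_noisePath_eval 𝓜 _ (measurableSet_movesOnly 𝓜 ω b m w)] at h3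
  have h4 := pow_le_measureReal_movesOnly 𝓜 hω0 hω1 hw
  have h5 := measureReal_compl_accurate_le 𝓜 h0 h1 hL b
  simp only [transition, Matrix.of_apply]
  linarith

end Transition

/-- An exploring man still draws his baseline with probability `1 / n`, so he deviates with
probability `ε * (1 - 1 / n)`. Bernoulli's inequality then leaves a surplus `ε` over `1 - n * ε`. -/
lemma le_measureReal_propose_self (𝓜 : Market n) {ε : ℝ} (h0 : 0 ≤ ε) (h1 : ε ≤ 1)
    (b : Profile n) :
    1 - n * ε + ε ≤ (noisePath 𝓜).real {z | propose ε b (z 0) = b} := by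
  have hn : (0 : ℝ) < n := by exact_mod_cast Nat.pos_of_neZero n
  have hm : ∀ k, MeasurableSet {x : ManNoise n | proposeMan ε (b k) x = b k} := fun k =>
    measurable_proposeMan ε (b k) (measurableSet_singleton (b k))
  have hset : {z : ℕ → Noise n | propose ε b (z 0) = b} =
      {z | z 0 ∈ Set.univ.pi fun k => {x : ManNoise n | proposeMan ε (b k) x = b k}} := by
    ext z
    refine ⟨fun h k _ => congrFun h k, fun h => funext fun k => h k (Set.mem_univ k)⟩
  have hk : ∀ k, (manLaw 𝓜 k).real {x : ManNoise n | proposeMan ε (b k) x = b k} =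
      1 + -(ε * (1 - (n : ℝ)⁻¹)) := by
    intro k
    have hi : ∀ x : ManNoise n,
        {x : ManNoise n | proposeMan ε (b k) x = b k}.indicator (1 : ManNoise n → ℝ) x =
          if proposeMan ε (b k) x = b k then 1 else 0 := fun x => by
      rw [Set.indicator_apply]; rfl
    rw [← integral_indicator_one (hm k)]
    simp_rw [hi]
    have := integral_proposeMan 𝓜 k h0 h1 (b k) (b k)
    simp only [proposeProb, if_true] at this
    rw [show 1 + -(ε * (1 - (n : ℝ)⁻¹)) = ε * (n : ℝ)⁻¹ + (1 - ε) * 1 by ring, ← this]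
  rw [hset, measureReal_noisePath_eval 𝓜 0 (MeasurableSet.univ_pi hm), measureReal_noiseLaw_pi,
    Finset.prod_congr rfl fun k _ => hk k]
  have hB : 1 + (n : ℝ) * (-(ε * (1 - (n : ℝ)⁻¹))) ≤ (1 + -(ε * (1 - (n : ℝ)⁻¹))) ^ n := by
    refine one_add_mul_le_pow ?_ n
    have h2 : 0 ≤ ε * (n : ℝ)⁻¹ := by positivity
    linarith
  have e : 1 + (n : ℝ) * (-(ε * (1 - (n : ℝ)⁻¹))) = 1 - n * ε + ε := by
    field_simp
    ring
  rw [e] at hB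
  simpa using hB

/-- It suffices to consider deterministic initial profiles. -/
lemma le_measureReal_pathLaw (𝓜 : Market n) (ν : Measure (Profile n)) [IsProbabilityMeasure ν]
    {E : Set (SampleSpace n)} (hE : MeasurableSet E) {p : ℝ}
    (h : ∀ a, p ≤ (noisePath 𝓜).real {z | (a, z) ∈ E}) : p ≤ (pathLaw 𝓜 ν).real E := by
  have hle : ENNReal.ofReal p ≤ (pathLaw 𝓜 ν) E := by
    rw [pathLaw, Measure.prod_apply hE]
    calc ENNReal.ofReal p = ∫⁻ _a, ENNReal.ofReal p ∂ν := by simp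
      _ ≤ _ := lintegral_mono fun a =>
        ENNReal.ofReal_le_of_le_toReal (h a)
  have : IsProbabilityMeasure (pathLaw 𝓜 ν) := by unfold pathLaw; infer_instance
  exact (ENNReal.ofReal_le_iff_le_toReal (measure_ne_top _ _)).1 hle

open Classical in
/-- The probability of proposing a stable matching that is the baseline profile, in terms of the
Markov chain of the baseline profiles. -/
lemma mul_sum_le_measureReal_stable (𝓜 : Market n) {L : ℕ} (hL : 0 < L) {ε : ℝ} (δ ω : ℝ)
    (h0 : 0 ≤ ε) (h1 : ε ≤ 1) (a : Profile n) (t : ℕ) :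
    (1 - n * ε + ε) * ∑ c with 𝓜.IsNash c, (transition 𝓜 L ε δ ω ^ (t / L)) a c ≤
      (noisePath 𝓜).real
        {z | 𝓜.IsStableMatching (proposal 𝓜 (fun _ => L) ε δ ω (a, z) t) ∧
          proposal 𝓜 (fun _ => L) ε δ ω (a, z) t = baseline 𝓜 (fun _ => L) ε δ ω (a, z) t} := by
  let F : Profile n → Set (ℕ → Noise n) := fun b =>
    {z | 𝓜.IsNash b ∧ propose ε b (z 0) = b}
  have hF : ∀ b, MeasurableSet (F b) := fun b => by
    refine (MeasurableSet.const (𝓜.IsNash b)).inter ?_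
    have : Measurable fun z : ℕ → Noise n => propose ε b (z 0) :=
      measurable_propose measurable_const (measurable_pi_apply 0)
    exact this (measurableSet_singleton b)
  -- A window of length `1`: the proposal uses only the noise of time `t`, which is independent of
  -- the baseline then in force.
  have hsum := measureReal_eq_sum_baseline 𝓜 (fun _ => L) ε δ ω a t 1 hF
    (fun b z z' h hz => ⟨hz.1, by rw [← h 0 one_pos]; exact hz.2⟩)
  have hsub : {z | (fun i => z (t + i)) ∈ F (baseline 𝓜 (fun _ => L) ε δ ω (a, z) t)} ⊆
      {z | 𝓜.IsStableMatching (proposal 𝓜 (fun _ => L) ε δ ω (a, z) t) ∧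
        proposal 𝓜 (fun _ => L) ε δ ω (a, z) t =
          baseline 𝓜 (fun _ => L) ε δ ω (a, z) t} := by
    rintro z ⟨hz1, hz2⟩
    have e : proposal 𝓜 (fun _ => L) ε δ ω (a, z) t =
        baseline 𝓜 (fun _ => L) ε δ ω (a, z) t := hz2
    exact ⟨by rw [e]; exact hz1.isStableMatching, e⟩
  refine le_trans ?_ (measureReal_mono hsub)
  rw [hsum, Finset.mul_sum]
  calc ∑ c with 𝓜.IsNash c, (1 - n * ε + ε) * (transition 𝓜 L ε δ ω ^ (t / L)) a c
      ≤ ∑ c with 𝓜.IsNash c,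
          (noisePath 𝓜).real {z | baseline 𝓜 (fun _ => L) ε δ ω (a, z) t = c} *
            (noisePath 𝓜).real (F c) := by
        refine Finset.sum_le_sum fun c hc => ?_
        have hc' : 𝓜.IsNash c := (Finset.mem_filter.1 hc).2
        simp_rw [baseline_eq_baseline_div 𝓜 hL ε δ ω a _ t, measureReal_baseline_mul]
        rw [mul_comm]
        have hFc : F c = {z | propose ε c (z 0) = c} := by
          ext z; exact ⟨fun h => h.2, fun h => ⟨hc', h⟩⟩
        rw [hFc]
        refine mul_le_mul_of_nonneg_left (le_measureReal_propose_self 𝓜 h0 h1 c) ?_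
        exact (stochastic_pow (transition_nonneg 𝓜 L ε δ ω) (sum_transition 𝓜 L ε δ ω) _).1 _ _
    _ ≤ _ := Finset.sum_le_sum_of_subset_of_nonneg (Finset.subset_univ _)
        fun c _ _ => mul_nonneg measureReal_nonneg measureReal_nonneg

end Convergence

end MatchingMarket

/-! ### Choice of constants and conclusion -/

open MatchingMarket

theorem mainTheorem5 (n : ℕ) [NeZero n] (p ω ε : ℝ)
    (hp0 : 0 < p) (hp1 : p < 1) (hω0 : 0 < ω) (hω1 : ω < 1)
    (hε0 : 0 < ε) (hεp : ε ≤ (1 - p) / n) :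
    ∃ τ₀ : ℕ, ∀ L : ℕ, τ₀ ≤ L →
      ∀ (𝓜 : MatchingMarket.Market n) (δ : ℝ), 0 < δ → δ < 𝓜.gap →
        ε ≤ δ / (4 * n) → ε ≤ (𝓜.gap - δ) / (4 * n) →
        ∀ ν : MeasureTheory.Measure (MatchingMarket.Profile n),
          MeasureTheory.IsProbabilityMeasure ν →
          ∃ T : ℕ, ∀ t : ℕ, T ≤ t →
            p ≤ (MatchingMarket.pathLaw 𝓜 ν).real
              {x | 𝓜.IsStableMatching (MatchingMarket.proposal 𝓜 (fun _ => L) ε δ ω x t) ∧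
                MatchingMarket.proposal 𝓜 (fun _ => L) ε δ ω x t =
                  MatchingMarket.baseline 𝓜 (fun _ => L) ε δ ω x t} := by
  classical
  have hn1 : (1 : ℝ) ≤ n := by exact_mod_cast NeZero.one_le
  have hn : (0 : ℝ) < n := by linarith
  have hnε : n * ε ≤ 1 - p := by
    rw [le_div_iff₀ hn] at hεp
    linarith
  have hεn : ε ≤ n * ε := le_mul_of_one_le_left hε0.le hn1
  have hε1 : ε ≤ 1 := by linarith
  set κ : ℝ := (min ω ((1 - ω) * (n : ℝ)⁻¹)) ^ n with hκ
  have hκ0 : 0 < κ := by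
    have := sub_pos.2 hω1
    exact pow_pos (lt_min hω0 (by positivity)) n
  have hκ1 : κ ≤ 1 := by
    have := sub_pos.2 hω1
    exact pow_le_one₀ (le_min hω0.le (by positivity)) ((min_le_left _ _).trans hω1.le)
  set N : ℕ := 2 * (n * n) + 1 with hN
  have hN0 : (0 : ℝ) < N := by exact_mod_cast Nat.succ_pos _
  -- The first bound keeps a favourable transition above `κ - η ≥ κ / 2`; the second is the leakage
  -- condition of `eventually_sum_pow_ge` with `ρ = κ / 2` and `θ = ε / 4`.
  set η : ℝ := min (κ / 2) ((κ / 2) ^ N * (ε / 4) / N) with hη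
  have hη0 : 0 < η := lt_min (by positivity) (by positivity)
  -- Chosen before the market, tolerance and initial law appear: the error bound involves none of
  -- them.
  obtain ⟨τ, hτ⟩ := exists_nat_ge (32 * (n : ℝ) ^ 4 / ε ^ 4 / η)
  refine ⟨τ + 1, fun L hL 𝓜 δ hδ0 hδ1 hεδ hεgap ν hν => ?_⟩
  have hL0 : 0 < L := by omega
  have hLη : 32 * (n : ℝ) ^ 4 / ε ^ 4 / L ≤ η := by
    have hLτ : (τ : ℝ) ≤ L := by exact_mod_cast (by omega : τ ≤ L)
    rw [div_le_iff₀ hη0] at hτ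
    rw [div_le_iff₀ (by exact_mod_cast hL0)]
    nlinarith
  have h4δ : 4 * ε ≤ δ := by
    rw [le_div_iff₀ (by positivity)] at hεδ
    linarith
  have h4gap : 4 * ε ≤ 𝓜.gap - δ := by
    rw [le_div_iff₀ (by positivity)] at hεgap
    linarith
  have hηκ : η ≤ κ / 2 := min_le_left _ _
  obtain ⟨K, hK⟩ := eventually_sum_pow_ge (M := transition 𝓜 L ε δ ω)
    (S := Finset.univ.filter 𝓜.IsNash) (ψ := 𝓜.potential) (ρ := κ / 2) (η := η) (N := N)
    (θ := ε / 4) (transition_nonneg 𝓜 L ε δ ω) (sum_transition 𝓜 L ε δ ω) (by positivity)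
    hη0.le (by linarith)
    (fun b hb => by
      have := one_sub_le_transition_self (ω := ω) hL0 hε0 hε1 h4δ h4gap
        (Finset.mem_filter.1 hb).2
      linarith)
    (fun b hb => by
      have hb' : ¬ 𝓜.IsNash b := fun h => hb (Finset.mem_filter.2 ⟨Finset.mem_univ _, h⟩)
      obtain ⟨m, w, hw, hlt⟩ := Market.exists_potential_lt hb'
      have := sub_le_transition_update hL0 hε0 hε1 h4δ h4gap hω0.le hω1.le hw
      exact ⟨_, hlt, by linarith⟩)
    𝓜.potential_le (by positivity) (by
      have : η ≤ (κ / 2) ^ N * (ε / 4) / N := min_le_right _ _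
      rw [le_div_iff₀ hN0] at this
      linarith)
  refine ⟨K * L, fun t ht => ?_⟩
  refine le_measureReal_pathLaw 𝓜 ν ?_ fun a => ?_
  · exact measurable_proposal 𝓜 (fun _ => L) ε δ ω t
      (Set.toFinite {c : Profile n × Profile n | 𝓜.IsStableMatching c.1 ∧ c.1 = c.2}).measurableSet
  · refine le_trans ?_ (mul_sum_le_measureReal_stable 𝓜 hL0 δ ω hε0.le hε1 a t)
    have h := hK (t / L) ((Nat.le_div_iff_mul_le hL0).2 ht) a
    have h2 : p + ε ≤ 1 - n * ε + ε := by linarith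
    -- The loss `(p + ε) * ε / 2` is at most `ε`, since `p + ε ≤ p + n * ε ≤ 1`.
    calc p ≤ (p + ε) * (1 - 2 * (ε / 4)) := by nlinarith
      _ ≤ (1 - n * ε + ε) * (1 - 2 * (ε / 4)) :=
          mul_le_mul_of_nonneg_right h2 (by linarith)
      _ ≤ _ := mul_le_mul_of_nonneg_left h (by linarith)
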